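/- Let $\Bbbk$ be an uncountable algebraically closed field of characteristic $0$, let $n\ge 0$, $A=\Bbbk[x_1,\dots,x_n]$ and $\mathcal V=\mathrm{Der}_{\Bbbk}(A)$. Let $A\#U(\mathcal V)$ be the smash product, i.e. the vector space $A\otimes U(\mathcal V)$ with the product $(f\otimes u)(g\otimes v)=\sum_i f\,u_i^{(1)}(g)\otimes u_i^{(2)}v$, where $\Delta(u)=\sum_i u_i^{(1)}\otimes u_i^{(2)}$; write $f\# u$ for $f\otimes u$. An $A\mathcal V$-module is a (left) module over $A\#U(\mathcal V)$. Let $\mathcal D\subset\mathrm{End}_{\Bbbk}(A)$ be the $n$-th Weyl algebra, generated by $A$ and $\mathcal V$. Every $A\mathcal V$-module is a $\mathcal D$-module through the algebra embedding $$\psi:\mathcal D\to A\#U(\mathcal V),\qquad x^r\partial^s\mapsto x^r\#\left(\tfrac{\partial}{\partial x_1}\right)^{s_1}\cdots\left(\tfrac{\partial}{\partial x_n}\right)^{s_n}$$ (this is the restriction to the factor $\mathcal D$ under the isomorphism $\mathcal D\otimes U(\mathcal L_+)\cong A\#U(\mathcal V)$ that extends $\psi$, where $\mathcal L_+$ is the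 Lie algebra of polynomial vector fields on affine $n$-space that vanish at the origin). For a finitely generated $\Bbbk$-algebra $R$ and a finitely generated $R$-module $M$, let $$\mathrm{GKdim}_R(M)=\limsup_{m\to\infty}\log_m\dim(C^mM_0),$$ where $C\ni 1$ is a finite-dimensional subspace that generates $R$ as an algebra and $M_0$ is a finite-dimensional subspace that generates $M$ as an $R$-module (the value does not depend on $C$ and $M_0$). For $R=A\#U(\mathcal V)$ or $R=\mathcal D$, an $R$-module $M$ is called holonomic if it is finitely generated over $R$ and either $M=0$ or $\mathrm{GKdim}_R(M)=n$. Then every holonomic $A\mathcal V$-module is holonomic as a $\mathcal D$-module; in particular, it is finitely generated over $\mathcal D$. -/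

import Mathlib

open scoped TensorProduct

noncomputable section

namespace AVMod

attribute [local instance 100] LieRing.ofAssociativeRing

/-! ### The enveloping algebra of vector fields and the smash product -/

section Smash

variable (k : Type*) [CommRing k] (A : Type*) [CommRing A] [Algebra k A]

/-- The enveloping algebra `U(V)` of the Lie algebra `V = Der_k(A)`. -/
abbrev UV : Type _ := UniversalEnvelopingAlgebra k (Derivation k A A)

/-- The inclusion `V → U(V)`. -/
abbrev vf : Derivation k A A →ₗ⁅k⁆ UV k A := UniversalEnvelopingAlgebra.ι k

/-- The coproduct of `U(V)`: the algebra map with `Δ η = η ⊗ 1 + 1 ⊗ η` for `η ∈ V`. -/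
def comulUV : UV k A →ₐ[k] UV k A ⊗[k] UV k A :=
  UniversalEnvelopingAlgebra.lift k
    { toFun := fun η => vf k A η ⊗ₜ 1 + 1 ⊗ₜ vf k A η
      map_add' := fun a b => by
        simp only [map_add, TensorProduct.add_tmul, TensorProduct.tmul_add]; abel
      map_smul' := fun c a => by
        simp only [map_smul, TensorProduct.smul_tmul', TensorProduct.tmul_smul, RingHom.id_apply,
          smul_add]
      map_lie' := fun {a b} => by
        simp only [LieHom.map_lie, LieRing.of_associative_ring_bracket, TensorProduct.sub_tmul,
          TensorProduct.tmul_sub, mul_add, add_mul, Algebra.TensorProduct.tmul_mul_tmul, one_mul,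
          mul_one]
        abel }

/-- The Lie algebra map `V → End_k(A)`. -/
def derToEnd : Derivation k A A →ₗ⁅k⁆ Module.End k A where
  toFun η := (η : A →ₗ[k] A)
  map_add' _ _ := rfl
  map_smul' _ _ := rfl
  map_lie' {a b} := by
    rw [Derivation.commutator_coe_linear_map]

/-- The natural `U(V)`-module structure on `A`. -/
def actUV : UV k A →ₐ[k] Module.End k A :=
  UniversalEnvelopingAlgebra.lift k (derToEnd k A)

/-- The operators `g ⊗ v ↦ ∑ u₁(g) ⊗ u₂ v` on `A ⊗ U(V)`, where `Δ u = ∑ u₁ ⊗ u₂`. -/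
def diagUV : UV k A →ₐ[k] Module.End k (A ⊗[k] UV k A) :=
  ((Module.endTensorEndAlgHom (R := k) (S := k) (A := k) (M := A) (N := UV k A)).comp
    (Algebra.TensorProduct.map (actUV k A) (Algebra.lmul k (UV k A)))).comp (comulUV k A)

/-- The smash product multiplication
`(f ⊗ u)(g ⊗ v) = ∑ f u₁(g) ⊗ u₂ v` on `A ⊗ U(V)`, as a bilinear map. -/
def smashMul : A ⊗[k] UV k A →ₗ[k] A ⊗[k] UV k A →ₗ[k] A ⊗[k] UV k A :=
  TensorProduct.lift
    ((((LinearMap.mul k (Module.End k (A ⊗[k] UV k A))).compl₂ (diagUV k A).toLinearMap).comp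
      (LinearMap.rTensorHom (UV k A))).comp (Algebra.lmul k A).toLinearMap)

variable {k A}

theorem smashMul_tmul (f : A) (u : UV k A) (y : A ⊗[k] UV k A) :
    smashMul k A (f ⊗ₜ u) y = (Algebra.lmul k A f).rTensor (UV k A) (diagUV k A u y) := rfl

theorem comulUV_vf (η : Derivation k A A) :
    comulUV k A (vf k A η) = vf k A η ⊗ₜ 1 + 1 ⊗ₜ vf k A η :=
  UniversalEnvelopingAlgebra.lift_ι_apply k _ η

theorem actUV_vf (η : Derivation k A A) : actUV k A (vf k A η) = (η : A →ₗ[k] A) :=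
  UniversalEnvelopingAlgebra.lift_ι_apply k _ η

theorem diagUV_vf (η : Derivation k A A) (g : A) (v : UV k A) :
    diagUV k A (vf k A η) (g ⊗ₜ v) = η g ⊗ₜ v + g ⊗ₜ (vf k A η * v) := by
  simp only [diagUV, AlgHom.comp_apply, comulUV_vf, map_add, Algebra.TensorProduct.map_tmul,
    map_one, actUV_vf, Module.endTensorEndAlgHom_apply, LinearMap.add_apply]
  rfl

theorem UV_induction {p : UV k A → Prop} (hv : ∀ η, p (vf k A η))
    (hc : ∀ r, p (algebraMap k _ r)) (ha : ∀ a b, p a → p b → p (a + b))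
    (hm : ∀ a b, p a → p b → p (a * b)) (u : UV k A) : p u := by
  let S : Subalgebra k (UV k A) :=
    { carrier := {u | p u}
      mul_mem' := fun {a b} h1 h2 => hm a b h1 h2
      add_mem' := fun {a b} h1 h2 => ha a b h1 h2
      algebraMap_mem' := hc }
  let j : Derivation k A A →ₗ⁅k⁆ S :=
    { toFun := fun η => ⟨vf k A η, hv η⟩
      map_add' := fun a b => Subtype.ext (map_add (vf k A) a b)
      map_smul' := fun c a => Subtype.ext (map_smul (vf k A) c a)
      map_lie' := fun {a b} => Subtype.ext (LieHom.map_lie (vf k A) a b) }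
  have h : S.val.comp (UniversalEnvelopingAlgebra.lift k j) = AlgHom.id k _ := by
    apply UniversalEnvelopingAlgebra.hom_ext
    ext η
    change ((UniversalEnvelopingAlgebra.lift k j (vf k A η) : S) : UV k A) = vf k A η
    rw [UniversalEnvelopingAlgebra.lift_ι_apply]
    rfl
  have h2 := DFunLike.congr_fun h u
  have h3 : ((UniversalEnvelopingAlgebra.lift k j u : S) : UV k A) = u := h2
  rw [← h3]
  exact (UniversalEnvelopingAlgebra.lift k j u).2

theorem smashMul_lmul (f : A) (x y : A ⊗[k] UV k A) :
    smashMul k A ((Algebra.lmul k A f).rTensor (UV k A) x) y =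
      (Algebra.lmul k A f).rTensor (UV k A) (smashMul k A x y) := by
  induction x with
  | zero => simp
  | add a b ha hb => simp only [map_add, LinearMap.add_apply, ha, hb]
  | tmul g u =>
    rw [LinearMap.rTensor_tmul, smashMul_tmul, smashMul_tmul, ← LinearMap.rTensor_comp_apply,
      ← Module.End.mul_eq_comp, ← map_mul]
    rfl

theorem smashMul_diag (u : UV k A) : ∀ x y : A ⊗[k] UV k A,
    smashMul k A (diagUV k A u x) y = diagUV k A u (smashMul k A x y) := by
  refine UV_induction (p := fun u => ∀ x y : A ⊗[k] UV k A,
    smashMul k A (diagUV k A u x) y = diagUV k A u (smashMul k A x y)) ?_ ?_ ?_ ?_ u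
  · intro η x y
    induction x with
    | zero => simp
    | add a b ha hb => simp only [map_add, LinearMap.add_apply, ha, hb]
    | tmul g v =>
      rw [diagUV_vf, map_add, LinearMap.add_apply, smashMul_tmul, smashMul_tmul, smashMul_tmul,
        map_mul, Module.End.mul_apply]
      generalize diagUV k A v y = z
      induction z with
      | zero => simp
      | add a b ha hb =>
        simp only [map_add] at ha hb ⊢
        rw [← ha, ← hb]
        abel
      | tmul h w =>
        simp only [LinearMap.rTensor_tmul, diagUV_vf, map_add, Algebra.coe_lmul_eq_mul,
          LinearMap.mul_apply', Derivation.leibniz, smul_eq_mul, TensorProduct.add_tmul]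
        rw [mul_comm h]
        abel
  · intro r x y
    simp [Module.algebraMap_end_apply]
  · intro a b ha hb x y
    simp only [map_add, LinearMap.add_apply, ha, hb]
  · intro a b ha hb x y
    simp only [map_mul, Module.End.mul_apply, ha, hb]

theorem smashMul_assoc (x y z : A ⊗[k] UV k A) :
    smashMul k A (smashMul k A x y) z = smashMul k A x (smashMul k A y z) := by
  induction x with
  | zero => simp
  | add a b ha hb => simp only [map_add, LinearMap.add_apply, ha, hb]
  | tmul f u => rw [smashMul_tmul, smashMul_tmul, smashMul_lmul, smashMul_diag]

theorem smashMul_one_left (y : A ⊗[k] UV k A) : smashMul k A (1 ⊗ₜ 1) y = y := by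
  rw [smashMul_tmul, map_one, map_one, Module.End.one_apply, Module.End.one_eq_id,
    LinearMap.rTensor_id, LinearMap.id_apply]

theorem diagUV_one_tmul_one (u : UV k A) : ∀ v : UV k A,
    diagUV k A u (1 ⊗ₜ v) = 1 ⊗ₜ (u * v) := by
  refine UV_induction (p := fun u => ∀ v : UV k A,
    diagUV k A u (1 ⊗ₜ v) = 1 ⊗ₜ (u * v)) ?_ ?_ ?_ ?_ u
  · intro η v
    rw [diagUV_vf, Derivation.map_one_eq_zero, TensorProduct.zero_tmul, zero_add]
  · intro r v
    rw [AlgHom.commutes, Module.algebraMap_end_apply, ← TensorProduct.tmul_smul,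
      Algebra.smul_def]
  · intro a b ha hb v
    rw [map_add, LinearMap.add_apply, ha, hb, add_mul, TensorProduct.tmul_add]
  · intro a b ha hb v
    rw [map_mul, Module.End.mul_apply, hb, ha, mul_assoc]

theorem smashMul_one_right (x : A ⊗[k] UV k A) : smashMul k A x (1 ⊗ₜ 1) = x := by
  induction x with
  | zero => simp
  | add a b ha hb => simp only [map_add, LinearMap.add_apply, ha, hb]
  | tmul f u =>
    rw [smashMul_tmul, diagUV_one_tmul_one, mul_one, LinearMap.rTensor_tmul]
    simp

variable (k A)

/-- The smash product `A # U(V)`: the vector space `A ⊗ U(V)`, with the smash multiplication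
(not the multiplication of the tensor product of algebras). -/
def SmashProduct : Type _ := A ⊗[k] UV k A

namespace SmashProduct

instance : AddCommGroup (SmashProduct k A) := inferInstanceAs (AddCommGroup (A ⊗[k] UV k A))

instance : Module k (SmashProduct k A) := inferInstanceAs (Module k (A ⊗[k] UV k A))

/-- The element `f # u`. -/
def mk (f : A) (u : UV k A) : SmashProduct k A := (f ⊗ₜ[k] u : A ⊗[k] UV k A)

instance : Ring (SmashProduct k A) where
  __ := (inferInstance : AddCommGroup (SmashProduct k A))
  mul x y := smashMul k A x y
  one := mk k A 1 1
  mul_assoc := smashMul_assoc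
  one_mul := smashMul_one_left
  mul_one := smashMul_one_right
  left_distrib x y z := map_add (smashMul k A x) y z
  right_distrib x y z := LinearMap.map_add₂ (smashMul k A) x y z
  zero_mul x := LinearMap.map_zero₂ (smashMul k A) x
  mul_zero x := map_zero (smashMul k A x)

instance : Algebra k (SmashProduct k A) :=
  Algebra.ofModule (fun r x y => LinearMap.map_smul₂ (smashMul k A) r x y)
    (fun r x y => map_smul (smashMul k A x) r y)

variable {k A}

theorem mul_def (x y : SmashProduct k A) : x * y = smashMul k A x y := rfl

theorem one_def : (1 : SmashProduct k A) = mk k A 1 1 := rfl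

/-- `(f # η)(g # μ) = f η(g) # μ + f g # η μ`. -/
theorem mk_vf_mul_mk (f g : A) (η : Derivation k A A) (v : UV k A) :
    mk k A f (vf k A η) * mk k A g v =
      mk k A (f * η g) v + mk k A (f * g) (vf k A η * v) := by
  rw [mul_def]
  simp only [mk, smashMul_tmul, diagUV_vf, map_add, LinearMap.rTensor_tmul]
  rfl

theorem mk_one_mul_mk (f g : A) (v : UV k A) :
    mk k A f 1 * mk k A g v = mk k A (f * g) v := by
  rw [mul_def]
  simp only [mk, smashMul_tmul, map_one, Module.End.one_apply, LinearMap.rTensor_tmul]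
  rfl

theorem induction_on {p : SmashProduct k A → Prop} (x : SmashProduct k A) (h0 : p 0)
    (ht : ∀ f u, p (mk k A f u)) (ha : ∀ x y, p x → p y → p (x + y)) : p x :=
  TensorProduct.induction_on (motive := p) x h0 ht ha

variable (k A) in
/-- The underlying linear map of the canonical representation of `A # U(V)` on `A`. -/
def toEndLin : SmashProduct k A →ₗ[k] Module.End k A :=
  TensorProduct.lift
    ((LinearMap.mul k (Module.End k A)).compl₁₂ (Algebra.lmul k A).toLinearMap
      (actUV k A).toLinearMap)

theorem toEndLin_mk (f : A) (u : UV k A) :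
    toEndLin k A (mk k A f u) = Algebra.lmul k A f * actUV k A u := rfl

theorem toEndLin_diag (u : UV k A) : ∀ y : A ⊗[k] UV k A,
    toEndLin k A (diagUV k A u y) = actUV k A u * toEndLin k A y := by
  refine UV_induction (p := fun u => ∀ y : A ⊗[k] UV k A,
    toEndLin k A (diagUV k A u y) = actUV k A u * toEndLin k A y) ?_ ?_ ?_ ?_ u
  · intro η y
    induction y with
    | zero => erw [map_zero, map_zero, mul_zero]
    | add a b ha hb =>
      rw [map_add]
      erw [map_add, map_add]
      rw [mul_add]
      exact congrArg₂ _ ha hb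
    | tmul g v =>
      rw [diagUV_vf]
      erw [map_add]
      change toEndLin k A (mk k A _ _) + toEndLin k A (mk k A _ _) =
        _ * toEndLin k A (mk k A _ _)
      rw [toEndLin_mk, toEndLin_mk, toEndLin_mk, map_mul, actUV_vf]
      ext a
      simp only [LinearMap.add_apply, Module.End.mul_apply, Algebra.coe_lmul_eq_mul,
        LinearMap.mul_apply', Derivation.coeFn_coe, Derivation.leibniz, smul_eq_mul]
      ring
  · intro r y
    rw [AlgHom.commutes, AlgHom.commutes, Module.algebraMap_end_apply, ← Algebra.smul_def]
    exact map_smul (toEndLin k A) r y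
  · intro a b ha hb y
    rw [map_add, map_add, add_mul, ← ha, ← hb]
    exact map_add (toEndLin k A) _ _
  · intro a b ha hb y
    rw [map_mul, map_mul, Module.End.mul_apply, ha, hb, mul_assoc]

theorem toEndLin_mul (x y : SmashProduct k A) :
    toEndLin k A (x * y) = toEndLin k A x * toEndLin k A y := by
  induction x using induction_on with
  | h0 => rw [zero_mul, map_zero, zero_mul]
  | ha a b ha hb => rw [add_mul, map_add, map_add, add_mul, ha, hb]
  | ht f u =>
    have h : ∀ z : A ⊗[k] UV k A, toEndLin k A ((Algebra.lmul k A f).rTensor (UV k A) z) =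
        Algebra.lmul k A f * toEndLin k A z := by
      intro z
      induction z with
      | zero =>
        rw [map_zero]
        exact (map_zero (toEndLin k A)).trans
          ((congrArg _ (map_zero (toEndLin k A))).trans (mul_zero _)).symm
      | add a b ha hb =>
        rw [map_add]
        erw [map_add, map_add]
        rw [mul_add]
        exact congrArg₂ _ ha hb
      | tmul g v =>
        change toEndLin k A (mk k A (f * g) v) = _ * toEndLin k A (mk k A g v)
        rw [toEndLin_mk, toEndLin_mk, map_mul, mul_assoc]
    rw [toEndLin_mk, mul_assoc]
    exact (h _).trans (congrArg _ (toEndLin_diag u y))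

variable (k A) in
/-- The canonical representation of `A # U(V)` on `A`: functions act by multiplication and vector
fields by derivations. -/
def toEnd : SmashProduct k A →ₐ[k] Module.End k A :=
  AlgHom.ofLinearMap (toEndLin k A)
    (by rw [one_def, toEndLin_mk, map_one, map_one, mul_one]) toEndLin_mul

theorem toEnd_mk (f : A) (u : UV k A) :
    toEnd k A (mk k A f u) = Algebra.lmul k A f * actUV k A u := rfl

end SmashProduct

end Smash

/-! ### The Weyl algebra and its embedding into the smash product -/

section Weyl

open MvPolynomial

variable (k : Type*) [Field k] (n : ℕ)

/-- The `n`-th Weyl algebra `D`: the subalgebra of `End_k(A)`, `A = k[x₁, …, xₙ]`, generated by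
the multiplications by elements of `A` and by the derivations of `A`. -/
def WeylAlgebra : Subalgebra k (Module.End k (MvPolynomial (Fin n) k)) :=
  Algebra.adjoin k
    (Set.range (fun f : MvPolynomial (Fin n) k => Algebra.lmul k (MvPolynomial (Fin n) k) f) ∪
      Set.range (fun η : Derivation k (MvPolynomial (Fin n) k) (MvPolynomial (Fin n) k) =>
        (η : MvPolynomial (Fin n) k →ₗ[k] MvPolynomial (Fin n) k)))

/-- The algebra `A # U(V)` for the affine space, `A = k[x₁, …, xₙ]` and `V = Der_k(A)`. -/
abbrev AV : Type _ := SmashProduct k (MvPolynomial (Fin n) k)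

/-- The element `∂ᵢ` of `U(V)`. -/
def dU (i : Fin n) : UV k (MvPolynomial (Fin n) k) := vf k _ (pderiv i)

theorem dU_comm (i j : Fin n) : dU k n i * dU k n j = dU k n j * dU k n i := by
  have h : ⁅(pderiv i : Derivation k (MvPolynomial (Fin n) k) (MvPolynomial (Fin n) k)),
      (pderiv j : Derivation k (MvPolynomial (Fin n) k) (MvPolynomial (Fin n) k))⁆ = 0 := by
    refine MvPolynomial.derivation_ext fun l => ?_
    classical
    rw [Derivation.commutator_apply, pderiv_X, pderiv_X]
    simp only [Pi.single_apply]
    split_ifs <;> simp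
  have h2 := congrArg (vf k (MvPolynomial (Fin n) k)) h
  rw [LieHom.map_lie, LieRing.of_associative_ring_bracket, map_zero, sub_eq_zero] at h2
  exact h2

/-- The element `∂^s = ∂₁^{s₁} ⋯ ∂ₙ^{sₙ}` of `U(V)`. -/
def dPow (s : Fin n →₀ ℕ) : UV k (MvPolynomial (Fin n) k) :=
  (List.ofFn fun i => dU k n i ^ s i).prod

variable {k n}

theorem dPow_zero : dPow k n 0 = 1 := by
  simp [dPow, List.ofFn_const]

theorem commute_aux {R : Type*} [Monoid R] {m : ℕ} (a : Fin m → R) (s : Fin m → ℕ) (j : Fin m)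
    (h : ∀ i, Commute (a j) (a i)) :
    (List.ofFn fun i => a i ^ (s i + (if j = i then 1 else 0))).prod =
      a j * (List.ofFn fun i => a i ^ s i).prod := by
  induction m with
  | zero => exact j.elim0
  | succ m ih =>
    rw [List.ofFn_succ, List.ofFn_succ, List.prod_cons, List.prod_cons]
    refine Fin.cases ?_ (fun l => ?_) j (motive := fun j => (∀ i, Commute (a j) (a i)) →
      a 0 ^ (s 0 + (if j = 0 then 1 else 0)) *
        (List.ofFn fun i : Fin m => a i.succ ^ (s i.succ + (if j = i.succ then 1 else 0))).prod =
      a j * (a 0 ^ s 0 * (List.ofFn fun i : Fin m => a i.succ ^ s i.succ).prod)) h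
    · intro _
      simp only [if_true, pow_succ', mul_assoc, (Fin.succ_ne_zero _).symm, if_false, add_zero]
    · intro h
      have := ih (fun i => a i.succ) (fun i => s i.succ) l (fun i => h i.succ)
      simp only [Fin.succ_inj, Fin.succ_ne_zero, if_false, add_zero]
      rw [this, ← mul_assoc, ← mul_assoc, ((h 0).pow_right (s 0)).eq]

theorem dPow_add_single (s : Fin n →₀ ℕ) (j : Fin n) :
    dPow k n (s + Finsupp.single j 1) = dU k n j * dPow k n s := by
  have := commute_aux (dU k n) s j (fun i => dU_comm k n j i)
  rw [dPow, dPow, ← this]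
  congr! 6 with i
  rw [Finsupp.add_apply, Finsupp.single_apply]

theorem exponent_induction {p : (Fin n →₀ ℕ) → Prop} (h0 : p 0)
    (h1 : ∀ s j, p s → p (s + Finsupp.single j 1)) (s : Fin n →₀ ℕ) : p s := by
  have key : ∀ (m : ℕ) (j : Fin n) (s : Fin n →₀ ℕ), p s → p (s + Finsupp.single j m) := by
    intro m j
    induction m with
    | zero => intro s hs; simpa using hs
    | succ m ih =>
      intro s hs
      rw [Finsupp.single_add, ← add_assoc]
      exact h1 _ _ (ih s hs)
  induction s using Finsupp.induction with
  | zero => exact h0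
  | single_add a b f _ _ ih => rw [add_comm]; exact key _ _ _ ih

theorem actUV_dPow (s t : Fin n →₀ ℕ) : ∃ c : ℕ, (c ≠ 0 ↔ s ≤ t) ∧
    actUV k (MvPolynomial (Fin n) k) (dPow k n s) (monomial t 1) =
      monomial (t - s) (c : k) := by
  induction s using exponent_induction with
  | h0 => exact ⟨1, by simp, by rw [dPow_zero, map_one]; simp⟩
  | h1 s j ih =>
    obtain ⟨c, hc, h⟩ := ih
    refine ⟨c * (t - s) j, ?_, ?_⟩
    · rw [mul_ne_zero_iff, hc]
      constructor
      · rintro ⟨h1, h2⟩ i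
        have := h1 i
        rw [Finsupp.tsub_apply] at h2
        rw [Finsupp.add_apply, Finsupp.single_apply]
        split_ifs with hi
        · subst hi; omega
        · simpa using this
      · intro h1
        refine ⟨fun i => le_trans (by simp) (h1 i), ?_⟩
        have := h1 j
        rw [Finsupp.add_apply, Finsupp.single_eq_same] at this
        rw [Finsupp.tsub_apply]
        omega
    · rw [dPow_add_single, map_mul, Module.End.mul_apply, h, dU, actUV_vf, Derivation.coeFn_coe,
        pderiv_monomial, tsub_add_eq_tsub_tsub, Nat.cast_mul]

variable (k n) in
/-- The combinations `∑ f_s # ∂^s`. -/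
def normalForm : ((Fin n →₀ ℕ) →₀ MvPolynomial (Fin n) k) →ₗ[k] AV k n :=
  Finsupp.lsum k fun s =>
    { toFun := fun f => SmashProduct.mk k _ f (dPow k n s)
      map_add' := fun f g => TensorProduct.add_tmul f g _
      map_smul' := fun _ _ => rfl }

theorem normalForm_single (s : Fin n →₀ ℕ) (f : MvPolynomial (Fin n) k) :
    normalForm k n (Finsupp.single s f) = SmashProduct.mk k _ f (dPow k n s) := by
  simp only [normalForm, Finsupp.lsum_single]
  rfl

theorem toEnd_normalForm_injective [CharZero k] (c : (Fin n →₀ ℕ) →₀ MvPolynomial (Fin n) k)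
    (h : SmashProduct.toEnd k _ (normalForm k n c) = 0) : c = 0 := by
  by_contra hc
  obtain ⟨t, ht⟩ := c.support.exists_minimal (Finsupp.support_nonempty_iff.2 hc)
  have h1 : SmashProduct.toEnd k _ (normalForm k n c) =
      c.sum fun s f => Algebra.lmul k _ f * actUV k _ (dPow k n s) := by
    conv_lhs => rw [← Finsupp.sum_single c]
    rw [Finsupp.sum, map_sum, map_sum]
    exact Finset.sum_congr rfl fun s _ => by rw [normalForm_single, SmashProduct.toEnd_mk]
  rw [h1] at h
  have h2 := LinearMap.congr_fun h (monomial t 1)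
  rw [Finsupp.sum, LinearMap.sum_apply, Finset.sum_eq_single t] at h2
  · obtain ⟨m, hm, hm2⟩ := actUV_dPow (k := k) t t
    rw [Module.End.mul_apply, hm2, tsub_self, LinearMap.zero_apply] at h2
    have h3 : (c t) * C (m : k) = 0 := h2
    rcases mul_eq_zero.1 h3 with h4 | h4
    · exact Finsupp.mem_support_iff.1 ht.1 h4
    · rw [C_eq_zero, Nat.cast_eq_zero] at h4
      exact hm.2 le_rfl h4
  · intro s hs hst
    obtain ⟨m, hm, hm2⟩ := actUV_dPow (k := k) s t
    have : m = 0 := by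
      by_contra h0
      have hle := hm.1 h0
      exact hst (le_antisymm hle (ht.2 hs hle))
    rw [Module.End.mul_apply, hm2, this, Nat.cast_zero, monomial_zero, map_zero]
  · intro h0
    exact absurd ht.1 h0

variable (k n) in
/-- The subalgebra of `A # U(V)` generated by the elements `f # 1` and `1 # ∂ᵢ`. -/
def weylInAV : Subalgebra k (AV k n) :=
  Algebra.adjoin k
    (Set.range (fun f : MvPolynomial (Fin n) k => SmashProduct.mk k _ f 1) ∪
      Set.range (fun i : Fin n => SmashProduct.mk k _ 1 (dU k n i)))

theorem weylInAV_le_range (x : AV k n) (hx : x ∈ weylInAV k n) :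
    x ∈ LinearMap.range (normalForm k n) := by
  have key : ∀ y ∈ LinearMap.range (normalForm k n), x * y ∈ LinearMap.range (normalForm k n) := by
    have mem : ∀ s f, SmashProduct.mk k _ f (dPow k n s) ∈ LinearMap.range (normalForm k n) :=
      fun s f => ⟨_, normalForm_single s f⟩
    have red : ∀ z : AV k n, (∀ s f, z * SmashProduct.mk k _ f (dPow k n s) ∈
        LinearMap.range (normalForm k n)) →
        ∀ y ∈ LinearMap.range (normalForm k n), z * y ∈ LinearMap.range (normalForm k n) := by
      rintro z hz _ ⟨c, rfl⟩
      induction c using Finsupp.induction_linear with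
      | zero => rw [map_zero, mul_zero]; exact zero_mem _
      | add a b ha hb => rw [map_add, mul_add]; exact add_mem ha hb
      | single s f => rw [normalForm_single]; exact hz s f
    induction hx using Algebra.adjoin_induction with
    | mem x hx =>
      apply red
      intro s f
      rcases hx with ⟨g, rfl⟩ | ⟨i, rfl⟩
      · simp only [SmashProduct.mk_one_mul_mk]
        exact mem _ _
      · simp only [dU, SmashProduct.mk_vf_mul_mk]
        refine add_mem (mem _ _) ?_
        have := dPow_add_single (k := k) s i
        rw [dU] at this
        rw [← this]
        exact mem _ _
    | algebraMap r =>
      intro y hy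
      rw [← Algebra.smul_def]
      exact Submodule.smul_mem _ _ hy
    | add a b _ _ ha hb =>
      intro y hy
      rw [add_mul]
      exact add_mem (ha y hy) (hb y hy)
    | mul a b _ _ ha hb =>
      intro y hy
      rw [mul_assoc]
      exact ha _ (hb y hy)
  rw [← mul_one x]
  apply key
  refine ⟨Finsupp.single 0 1, ?_⟩
  rw [normalForm_single, dPow_zero]
  rfl

variable (k n) in
/-- The canonical representation, restricted to the subalgebra generated by the `f # 1` and the
`1 # ∂ᵢ`. -/
def weylInAVToEnd : weylInAV k n →ₐ[k] Module.End k (MvPolynomial (Fin n) k) :=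
  (SmashProduct.toEnd k _).comp (weylInAV k n).val

theorem weylInAVToEnd_injective [CharZero k] : Function.Injective (weylInAVToEnd k n) := by
  rw [injective_iff_map_eq_zero]
  intro x hx
  obtain ⟨c, hc⟩ := weylInAV_le_range x.1 x.2
  have h : SmashProduct.toEnd k _ (normalForm k n c) = 0 := by rw [hc]; exact hx
  have := toEnd_normalForm_injective c h
  rw [this, map_zero] at hc
  exact Subtype.ext hc.symm

theorem weylAlgebra_le_range : WeylAlgebra k n ≤ (weylInAVToEnd k n).range := by
  have hf : ∀ f : MvPolynomial (Fin n) k,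
      Algebra.lmul k _ f ∈ (weylInAVToEnd k n).range := fun f =>
    ⟨⟨SmashProduct.mk k _ f 1, Algebra.subset_adjoin (Or.inl ⟨f, rfl⟩)⟩, by
      change SmashProduct.toEnd k _ (SmashProduct.mk k _ f 1) = _
      rw [SmashProduct.toEnd_mk, map_one, mul_one]⟩
  have hd : ∀ i : Fin n, ((pderiv i : Derivation k (MvPolynomial (Fin n) k) _) :
      MvPolynomial (Fin n) k →ₗ[k] MvPolynomial (Fin n) k) ∈ (weylInAVToEnd k n).range := fun i =>
    ⟨⟨SmashProduct.mk k _ 1 (dU k n i), Algebra.subset_adjoin (Or.inr ⟨i, rfl⟩)⟩, by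
      change SmashProduct.toEnd k _ (SmashProduct.mk k _ 1 (dU k n i)) = _
      rw [SmashProduct.toEnd_mk, map_one, one_mul, dU, actUV_vf]⟩
  have sum_der : ∀ (F : Fin n → Derivation k (MvPolynomial (Fin n) k) (MvPolynomial (Fin n) k))
      (a : MvPolynomial (Fin n) k), (∑ i, F i) a = ∑ i, F i a := fun F a =>
    (congrFun (map_sum Derivation.coeFnAddMonoidHom F Finset.univ) a).trans
      (Finset.sum_apply a Finset.univ _)
  apply Algebra.adjoin_le
  rintro _ (⟨f, rfl⟩ | ⟨η, rfl⟩)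
  · exact hf f
  · have : (η : MvPolynomial (Fin n) k →ₗ[k] MvPolynomial (Fin n) k) =
        ∑ i, Algebra.lmul k _ (η (X i)) *
          ((pderiv i : Derivation k (MvPolynomial (Fin n) k) _) :
            MvPolynomial (Fin n) k →ₗ[k] MvPolynomial (Fin n) k) := by
      have h : η = ∑ i, η (X i) • (pderiv i : Derivation k (MvPolynomial (Fin n) k) _) := by
        refine MvPolynomial.derivation_ext fun j => ?_
        classical
        simp [sum_der, pderiv_X, Pi.single_apply]
      refine LinearMap.ext fun a => ?_
      conv_lhs => rw [h]
      simp [sum_der]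
    simp only
    rw [this]
    exact sum_mem fun i _ => mul_mem (hf _) (hd i)

variable (k n) in
/-- The embedding `ψ` of the Weyl algebra `D` into `A # U(V)`, `x^r ∂^s ↦ x^r # ∂₁^{s₁} ⋯ ∂ₙ^{sₙ}`
(see `weylToAV_monomial`).
It is the inverse of the canonical representation on the subalgebra of `A # U(V)` generated by
the `f # 1` and the `1 # ∂ᵢ`. -/
def weylToAV [CharZero k] : WeylAlgebra k n →ₐ[k] AV k n :=
  ((weylInAV k n).val.comp
    (AlgEquiv.ofInjective (weylInAVToEnd k n) weylInAVToEnd_injective).symm.toAlgHom).comp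
      (Subalgebra.inclusion weylAlgebra_le_range)

theorem weylToAV_eq [CharZero k] (d : WeylAlgebra k n) (x : AV k n) (hx : x ∈ weylInAV k n)
    (h : SmashProduct.toEnd k _ x = d) : weylToAV k n d = x := by
  have : (AlgEquiv.ofInjective (weylInAVToEnd k n) weylInAVToEnd_injective).symm
      (Subalgebra.inclusion weylAlgebra_le_range d) = ⟨x, hx⟩ := by
    rw [AlgEquiv.symm_apply_eq]
    exact Subtype.ext h.symm
  exact congrArg Subtype.val this

variable (k n) in
/-- Multiplication by `f`, as an element of the Weyl algebra. -/
def weylMul (f : MvPolynomial (Fin n) k) : WeylAlgebra k n :=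
  ⟨Algebra.lmul k _ f, Algebra.subset_adjoin (Or.inl ⟨f, rfl⟩)⟩

variable (k n) in
/-- The partial derivative `∂ᵢ`, as an element of the Weyl algebra. -/
def weylD (i : Fin n) : WeylAlgebra k n :=
  ⟨((pderiv i : Derivation k (MvPolynomial (Fin n) k) _) :
    MvPolynomial (Fin n) k →ₗ[k] MvPolynomial (Fin n) k), Algebra.subset_adjoin (Or.inr ⟨_, rfl⟩)⟩

theorem weylToAV_mul [CharZero k] (f : MvPolynomial (Fin n) k) :
    weylToAV k n (weylMul k n f) = SmashProduct.mk k _ f 1 :=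
  weylToAV_eq _ _ (Algebra.subset_adjoin (Or.inl ⟨f, rfl⟩))
    (by rw [SmashProduct.toEnd_mk, map_one, mul_one]; rfl)

theorem weylToAV_d [CharZero k] (i : Fin n) :
    weylToAV k n (weylD k n i) = SmashProduct.mk k _ 1 (vf k _ (pderiv i)) :=
  weylToAV_eq _ _ (Algebra.subset_adjoin (Or.inr ⟨i, rfl⟩))
    (by rw [SmashProduct.toEnd_mk, map_one, one_mul, actUV_vf]; rfl)

theorem mk_one_mul_mk_one (f : MvPolynomial (Fin n) k) (u v : UV k (MvPolynomial (Fin n) k)) :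
    (SmashProduct.mk k _ f u : AV k n) * SmashProduct.mk k _ 1 v =
      SmashProduct.mk k _ f (u * v) := by
  rw [SmashProduct.mul_def]
  simp only [SmashProduct.mk]
  rw [smashMul_tmul, diagUV_one_tmul_one, LinearMap.rTensor_tmul]
  simp
  rfl

theorem weylToAV_monomial [CharZero k] (f : MvPolynomial (Fin n) k) (s : Fin n →₀ ℕ) :
    weylToAV k n (weylMul k n f * (List.ofFn fun i => weylD k n i ^ s i).prod) =
      SmashProduct.mk k _ f (List.ofFn fun i => vf k _ (pderiv i) ^ s i).prod := by
  have hp : ∀ (u : UV k (MvPolynomial (Fin n) k)) (m : ℕ),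
      (SmashProduct.mk k _ 1 u : AV k n) ^ m = SmashProduct.mk k _ 1 (u ^ m) := by
    intro u m
    induction m with
    | zero => rw [pow_zero, pow_zero]; rfl
    | succ m ih => rw [pow_succ, ih, mk_one_mul_mk_one, pow_succ]
  have hl : ∀ l : List (UV k (MvPolynomial (Fin n) k)),
      (l.map fun u => (SmashProduct.mk k _ 1 u : AV k n)).prod =
        SmashProduct.mk k _ 1 l.prod := by
    intro l
    induction l with
    | nil => rfl
    | cons a l ih => rw [List.map_cons, List.prod_cons, ih, mk_one_mul_mk_one, List.prod_cons]
  rw [map_mul, weylToAV_mul, map_list_prod, List.map_ofFn]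
  have : (⇑(weylToAV k n) ∘ fun i => weylD k n i ^ s i) =
      (fun u => (SmashProduct.mk k _ 1 u : AV k n)) ∘ fun i => vf k _ (pderiv i) ^ s i := by
    funext i
    rw [Function.comp_apply, map_pow, weylToAV_d, hp, Function.comp_apply]
  rw [this, ← List.map_ofFn, hl, mk_one_mul_mk_one, one_mul]

variable (k n) in
/-- The `D`-module underlying an `AV`-module `M`: the vector space `M`, on which `D` acts through
`ψ : D → A # U(V)`. -/
@[nolint unusedArguments]
def WeylRestrict (M : Type*) [AddCommGroup M] [Module (AV k n) M] : Type _ := M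

section WeylRestrict

variable (M : Type*) [AddCommGroup M] [Module (AV k n) M]

instance : AddCommGroup (WeylRestrict k n M) := inferInstanceAs (AddCommGroup M)

instance [Module k M] : Module k (WeylRestrict k n M) := inferInstanceAs (Module k M)

instance [CharZero k] : Module (WeylAlgebra k n) (WeylRestrict k n M) :=
  Module.compHom M (weylToAV k n).toRingHom

theorem WeylRestrict.smul_def [CharZero k] (d : WeylAlgebra k n) (v : M) :
    d • (show WeylRestrict k n M from v) = (weylToAV k n d • v : M) := rfl

instance [CharZero k] [Module k M] [IsScalarTower k (AV k n) M] :
    IsScalarTower k (WeylAlgebra k n) (WeylRestrict k n M) where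
  smul_assoc r d v := by
    have h : ∀ w : M, weylToAV k n (r • d) • w = r • (weylToAV k n d • w) := fun w => by
      rw [map_smul, smul_assoc]
    exact h v

end WeylRestrict

end Weyl

/-! ### Gelfand–Kirillov dimension and holonomic modules -/

section GK

open Filter

set_option linter.unusedSectionVars false

variable (k : Type*) [Field k] (R : Type*) [Ring R] [Algebra k R]
  (M : Type*) [AddCommGroup M] [Module k M] [Module R M] [IsScalarTower k R M]

variable {R M} in
/-- `C` is a finite-dimensional subspace of `R` that contains `1` and generates the algebra `R`, and
`M₀` is a finite-dimensional subspace of `M` that generates the module `M`. -/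
structure IsGeneratingPair (C : Submodule k R) (M₀ : Submodule k M) : Prop where
  finite_left : FiniteDimensional k C
  one_mem : (1 : R) ∈ C
  adjoin_eq_top : Algebra.adjoin k (C : Set R) = ⊤
  finite_right : FiniteDimensional k M₀
  span_eq_top : Submodule.span R (M₀ : Set M) = ⊤

variable {R M} in
/-- The upper limit of `log_m (dim C^m M₀)`; here `C ^ m • M₀` is the span of the `r • v` with
`r ∈ C ^ m` and `v ∈ M₀`. -/
def growth (C : Submodule k R) (M₀ : Submodule k M) : EReal :=
  limsup (fun m : ℕ => ((Real.logb m (Module.finrank k (C ^ m • M₀ : Submodule k M)) : ℝ) : EReal))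
    atTop

variable {k R M} in
theorem IsGeneratingPair.le_pow {C : Submodule k R} {M₀ : Submodule k M}
    (h : IsGeneratingPair k C M₀) (r : R) : ∃ a, r ∈ C ^ a := by
  have mono : Monotone fun a : ℕ => C ^ a :=
    pow_right_monotone (Submodule.one_le.2 h.one_mem)
  have hr : r ∈ Algebra.adjoin k (C : Set R) := by rw [h.adjoin_eq_top]; trivial
  induction hr using Algebra.adjoin_induction with
  | mem x hx => exact ⟨1, by simpa using hx⟩
  | algebraMap r => exact ⟨0, by rw [pow_zero]; exact Submodule.algebraMap_mem r⟩
  | add x y _ _ hx hy =>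
    obtain ⟨a, ha⟩ := hx
    obtain ⟨b, hb⟩ := hy
    exact ⟨max a b, add_mem (mono (le_max_left a b) ha) (mono (le_max_right a b) hb)⟩
  | mul x y _ _ hx hy =>
    obtain ⟨a, ha⟩ := hx
    obtain ⟨b, hb⟩ := hy
    exact ⟨a + b, by rw [pow_add]; exact Submodule.mul_mem_mul ha hb⟩

variable {k R M} in
theorem IsGeneratingPair.le_pow_smul {C : Submodule k R} {M₀ : Submodule k M}
    (h : IsGeneratingPair k C M₀) (v : M) : ∃ a, v ∈ C ^ a • M₀ := by
  have mono : Monotone fun a : ℕ => C ^ a • M₀ := fun a b hab =>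
    Submodule.smul_mono_left (pow_right_monotone (Submodule.one_le.2 h.one_mem) hab)
  have hv : v ∈ Submodule.span R (M₀ : Set M) := by rw [h.span_eq_top]; trivial
  induction hv using Submodule.span_induction with
  | mem x hx => exact ⟨0, by rw [pow_zero, Submodule.one_smul]; exact hx⟩
  | zero => exact ⟨0, zero_mem _⟩
  | add x y _ _ hx hy =>
    obtain ⟨a, ha⟩ := hx
    obtain ⟨b, hb⟩ := hy
    exact ⟨max a b, add_mem (mono (le_max_left a b) ha) (mono (le_max_right a b) hb)⟩
  | smul r x _ hx =>
    obtain ⟨a, ha⟩ := h.le_pow r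
    obtain ⟨b, hb⟩ := hx
    exact ⟨a + b, by rw [pow_add, ← smul_eq_mul, Submodule.smul_assoc]; exact Submodule.smul_mem_smul ha hb⟩

variable {k} in
theorem exists_le_of_directed {V : Type*} [AddCommGroup V] [Module k V] (F : ℕ → Submodule k V)
    (hF : Monotone F) (hV : ∀ v, ∃ a, v ∈ F a) (W : Submodule k V) [FiniteDimensional k W] :
    ∃ a, W ≤ F a := by
  obtain ⟨S, hS⟩ := (Module.Finite.iff_fg.1 ‹FiniteDimensional k W› : W.FG)
  choose a ha using hV
  refine ⟨S.sup a, ?_⟩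
  rw [← hS, Submodule.span_le]
  exact fun v hv => hF (Finset.le_sup hv) (ha v)

variable {k R M} in
theorem growth_le {C C' : Submodule k R} {M₀ M₀' : Submodule k M}
    (h : IsGeneratingPair k C M₀) (h' : IsGeneratingPair k C' M₀') :
    growth k C' M₀' ≤ growth k C M₀ := by
  have mono : Monotone fun a : ℕ => C ^ a := pow_right_monotone (Submodule.one_le.2 h.one_mem)
  have monoM : Monotone fun a : ℕ => C ^ a • M₀ := fun a b hab =>
    Submodule.smul_mono_left (mono hab)
  have := h'.finite_left
  have := h'.finite_right
  obtain ⟨a, ha⟩ := exists_le_of_directed _ mono h.le_pow C'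
  obtain ⟨b, hb⟩ := exists_le_of_directed _ monoM h.le_pow_smul M₀'
  have hfin : ∀ m, FiniteDimensional k (C ^ m • M₀ : Submodule k M) := fun m => by
    have h1 : C.FG := Module.Finite.iff_fg.1 h.finite_left
    have h2 : M₀.FG := Module.Finite.iff_fg.1 h.finite_right
    have := Module.Finite.iff_fg.2
      ((h1.pow m).map₂ (Algebra.lsmul k k M : R →ₐ[k] Module.End k M).toLinearMap h2)
    refine Submodule.finiteDimensional_of_le (Submodule.smul_le.2 fun r hr v hv => ?_)
      (S₂ := Submodule.map₂ (Algebra.lsmul k k M : R →ₐ[k] Module.End k M).toLinearMap (C ^ m) M₀)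
    exact Submodule.apply_mem_map₂
      (Algebra.lsmul k k M : R →ₐ[k] Module.End k M).toLinearMap hr hv
  have hle : ∀ m, 1 ≤ m → Module.finrank k (C' ^ m • M₀' : Submodule k M) ≤
      Module.finrank k (C ^ ((a + b + 1) * m) • M₀ : Submodule k M) := fun m hm => by
    have := hfin ((a + b + 1) * m)
    refine Submodule.finrank_mono ?_
    calc C' ^ m • M₀' ≤ (C ^ a) ^ m • (C ^ b • M₀) :=
          Submodule.smul_mono (pow_le_pow_left' ha m) hb
      _ = C ^ (a * m + b) • M₀ := by
            rw [← Submodule.smul_assoc, smul_eq_mul, ← pow_mul, ← pow_add]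
      _ ≤ _ := monoM (by nlinarith)
  refine EReal.le_of_forall_lt_iff_le.1 fun c hc => ?_
  have hev := eventually_lt_of_limsup_lt hc
  have hp : 0 < a + b + 1 := by omega
  have hlim : Tendsto (fun m : ℕ => ((c * (Real.logb m ((a + b + 1 : ℕ) : ℝ) + 1) : ℝ) : EReal))
      atTop (nhds (c : EReal)) := by
    refine EReal.tendsto_coe.2 ?_
    have h1 : Tendsto (fun m : ℕ => Real.logb m ((a + b + 1 : ℕ) : ℝ)) atTop (nhds 0) :=
      (Real.tendsto_log_atTop.comp tendsto_natCast_atTop_atTop).const_div_atTop _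
    simpa using (h1.add_const 1).const_mul c
  refine le_trans (limsup_le_limsup ?_) hlim.limsup_eq.le
  have hmul : Tendsto (fun m : ℕ => (a + b + 1) * m) atTop atTop :=
    tendsto_id.const_mul_atTop' hp
  filter_upwards [hmul.eventually hev, eventually_ge_atTop 2] with m hm hm2
  rw [EReal.coe_le_coe_iff]
  have hm' := (EReal.coe_lt_coe_iff.1 hm).le
  have hm1 : (1 : ℝ) < m := by exact_mod_cast hm2
  have hP : (0 : ℝ) < ((a + b + 1 : ℕ) : ℝ) := by exact_mod_cast hp
  have hpm1 : (1 : ℝ) < (((a + b + 1) * m : ℕ) : ℝ) := by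
    have : 1 < (a + b + 1) * m := by nlinarith
    exact_mod_cast this
  have hc0 : 0 ≤ c := by
    refine le_trans ?_ hm'
    rw [Real.logb]
    exact div_nonneg (Real.log_natCast_nonneg _) (Real.log_natCast_nonneg _)
  have hlog : Real.logb m ((a + b + 1 : ℕ) : ℝ) + 1 =
      Real.log (((a + b + 1) * m : ℕ) : ℝ) / Real.log m := by
    rw [Nat.cast_mul, Real.log_mul hP.ne' (by positivity), add_div,
      div_self (Real.log_pos hm1).ne', Real.logb]
  rw [hlog, Real.logb, ← mul_div_assoc]
  refine div_le_div_of_nonneg_right ?_ (Real.log_pos hm1).le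
  rw [Real.logb, div_le_iff₀ (Real.log_pos hpm1)] at hm'
  refine le_trans ?_ hm'
  rcases Nat.eq_zero_or_pos (Module.finrank k (C' ^ m • M₀' : Submodule k M)) with h0 | h0
  · rw [h0, Nat.cast_zero, Real.log_zero]
    exact Real.log_natCast_nonneg _
  · exact Real.log_le_log (by exact_mod_cast h0) (by exact_mod_cast hle m (by omega))

/-- The Gelfand–Kirillov dimension of the finitely generated `R`-module `M` over the finitely
generated algebra `R`: the value of `growth k C M₀` on finite-dimensional generating subspaces
`C ∋ 1` and `M₀`, which does not depend on the choice (see `gkDim_eq`). -/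
def gkDim : EReal :=
  ⨆ (C : Submodule k R) (M₀ : Submodule k M) (_ : IsGeneratingPair k C M₀), growth k C M₀

variable {k R M} in
theorem gkDim_eq {C : Submodule k R} {M₀ : Submodule k M} (h : IsGeneratingPair k C M₀) :
    gkDim k R M = growth k C M₀ :=
  le_antisymm (iSup_le fun _ => iSup_le fun _ => iSup_le fun h' => growth_le h h')
    (le_iSup_of_le C (le_iSup_of_le M₀ (le_iSup_of_le h le_rfl)))

/-- A finitely generated `R`-module `M` is holonomic (with respect to `n`) if `M = 0` or its
Gelfand–Kirillov dimension is `n`. -/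
def IsHolonomic (n : ℕ) : Prop :=
  Module.Finite R M ∧ (Subsingleton M ∨ gkDim k R M = n)

end GK

end AVMod

end

noncomputable section

namespace AVMod

/-! ### Growth estimates and the core of Bernstein's inequality -/

section GK
open Filter

/-! Two facts carry the argument: the smash product is generated by ψ(D) and its centralizer, and
nonzero D-modules satisfy Bernstein's inequality.

Generation (`adjoin_weylGen_union_centralizer`): encode f # g∂ᵢ as f ⊗ g in A ⊗ A = k[x, y]. The
commutator with xⱼ sees only the product fg, i.e. the restriction to the diagonal y = x, and the
commutator with ∂ⱼ is the diagonal translation derivation. Hence p(y - x)∂ᵢ with p(0) = 0 commutes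
with ψ(D). Since k[x, y] is generated over k[x] by the differences y - x, these elements together
with ψ(D) give every vector field. A holonomic M ≠ 0 has a generating pair, so the smash product is
a finitely generated algebra, and one may take C = ψ(B) + E, with B the span of 1, the xᵢ and the
∂ᵢ, and E finite-dimensional in the centralizer.

Bernstein (`pow_le_finrank_weylGen_pow_smul`): B^m acts faithfully from B^m v to B^(2m) v, so dim
B^m ≤ (dim B^(2m) v)². Counting monomials then makes B^m v grow at least like m^n.

Conclusion (`isHolonomic_of_commuting`): put Nⱼ = D · C^j M₀. If the chain never stalled, each
nonzero step would contribute at least q^n dimensions to B^(Kq) C^J M₀. Taking J = q gives dim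
C^((K+1)q) M₀ ≥ q^(n+1), contradicting GKdim n. If it stalls at j, then Nⱼ is stable under ψ(D) and
under E, so Nⱼ = M and C^j M₀ generates M over D. Since ψ(B) ⊆ C, the dimension over D is at most n;
Bernstein gives at least n. -/

theorem le_growth_of_le_finrank {k : Type*} [Field k] {R : Type*} [Ring R] [Algebra k R]
    {M : Type*} [AddCommGroup M] [Module k M] [Module R M] [IsScalarTower k R M]
    {C : Submodule k R} {M₀ : Submodule k M} {K d : ℕ} (hK : 0 < K)
    (h : ∀ q : ℕ, q ^ d ≤ Module.finrank k (C ^ (K * q) • M₀ : Submodule k M)) :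
    (d : EReal) ≤ growth k C M₀ := by
  -- The subsequence m = Kq suffices for a lower bound on an upper limit. Along it, log_{Kq}(q^d) =
  -- d / (log_q K + 1), which tends to d.
  have hmul : Tendsto (fun q : ℕ => K * q) atTop atTop := tendsto_id.const_mul_atTop' hK
  have hlim : Tendsto (fun q : ℕ => (((d : ℝ) * (Real.logb q (K : ℝ) + 1)⁻¹ : ℝ) : EReal))
      atTop (nhds ((d : ℝ) : EReal)) := by
    refine EReal.tendsto_coe.2 ?_
    have h1 : Tendsto (fun q : ℕ => Real.logb q (K : ℝ)) atTop (nhds 0) :=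
      (Real.tendsto_log_atTop.comp tendsto_natCast_atTop_atTop).const_div_atTop _
    have h2 := ((h1.add_const 1).inv₀ (by norm_num)).const_mul (d : ℝ)
    simpa using h2
  have h1 : (d : EReal) = ((d : ℝ) : EReal) := by simp
  rw [h1, ← hlim.limsup_eq]
  refine le_trans ?_ (limsup_le_limsup_of_le hmul)
  rw [← Filter.limsup_comp]
  refine limsup_le_limsup ?_
  filter_upwards [eventually_ge_atTop 2] with q hq
  rw [Function.comp_apply, EReal.coe_le_coe_iff]
  have hq1 : (1 : ℝ) < q := by exact_mod_cast hq
  have hK0 : (0 : ℝ) < K := by exact_mod_cast hK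
  have hlq := Real.log_pos hq1
  have hlK : 0 ≤ Real.log K := Real.log_natCast_nonneg _
  have hle : (d : ℝ) * Real.log q ≤
      Real.log (Module.finrank k (C ^ (K * q) • M₀ : Submodule k M)) := by
    rw [← Real.log_pow]
    exact Real.log_le_log (by positivity) (by exact_mod_cast h q)
  have e1 : (Real.logb q (K : ℝ) + 1)⁻¹ = Real.log q / Real.log ((K * q : ℕ) : ℝ) := by
    rw [Nat.cast_mul, Real.log_mul hK0.ne' (by positivity), Real.logb, div_add_one hlq.ne',
      inv_div]
  rw [e1, Real.logb, ← mul_div_assoc]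
  refine div_le_div_of_nonneg_right hle ?_
  rw [Nat.cast_mul, Real.log_mul hK0.ne' (by positivity)]
  linarith

variable {k : Type*} [Field k] {R : Type*} [Ring R] [Algebra k R]
    {M : Type*} [AddCommGroup M] [Module k M] [Module R M] [IsScalarTower k R M]

theorem finiteDimensional_smul (C : Submodule k R) (M₀ : Submodule k M) [FiniteDimensional k C]
    [FiniteDimensional k M₀] : FiniteDimensional k (C • M₀ : Submodule k M) := by
  have h1 : C.FG := Module.Finite.iff_fg.1 inferInstance
  have h2 : M₀.FG := Module.Finite.iff_fg.1 inferInstance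
  have := Module.Finite.iff_fg.2
    (h1.map₂ (Algebra.lsmul k k M : R →ₐ[k] Module.End k M).toLinearMap h2)
  refine Submodule.finiteDimensional_of_le (Submodule.smul_le.2 fun r hr v hv => ?_)
    (S₂ := Submodule.map₂ (Algebra.lsmul k k M : R →ₐ[k] Module.End k M).toLinearMap C M₀)
  exact Submodule.apply_mem_map₂
    (Algebra.lsmul k k M : R →ₐ[k] Module.End k M).toLinearMap hr hv

theorem finiteDimensional_pow (C : Submodule k R) [FiniteDimensional k C] (m : ℕ) :
    FiniteDimensional k (C ^ m : Submodule k R) :=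
  Module.Finite.iff_fg.2 ((Module.Finite.iff_fg.1 ‹FiniteDimensional k C› : C.FG).pow m)

theorem finiteDimensional_pow_smul (C : Submodule k R) (M₀ : Submodule k M)
    [FiniteDimensional k C] [FiniteDimensional k M₀] (m : ℕ) :
    FiniteDimensional k (C ^ m • M₀ : Submodule k M) :=
  have := finiteDimensional_pow C m
  finiteDimensional_smul _ _

theorem one_mem_pow {C : Submodule k R} (h : (1 : R) ∈ C) (m : ℕ) : (1 : R) ∈ C ^ m :=
  by simpa using Submodule.pow_mem_pow C h m

/-- If `B` satisfies `[B, B] ⊆ k`, then `[B ^ (m + 1), B] ⊆ B ^ m`. -/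
theorem commutator_mem_pow {B : Submodule k R}
    (hc : ∀ a ∈ B, ∀ b ∈ B, a * b - b * a ∈ (1 : Submodule k R)) (m : ℕ) {a b : R}
    (ha : a ∈ B ^ (m + 1)) (hb : b ∈ B) : a * b - b * a ∈ B ^ m := by
  induction m generalizing a with
  | zero =>
    rw [zero_add, pow_one] at ha
    exact pow_zero B ▸ hc a ha b hb
  | succ m ih =>
    rw [pow_succ] at ha
    induction ha using Submodule.mul_induction_on' with
    | mem_mul_mem x hx y hy =>
      -- Bracketing with b is a derivation. In the first term [y, b] is a scalar, so only x remains;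
      -- in the second the induction hypothesis lowers the degree of x by one and y restores it.
      have e : x * y * b - b * (x * y) = x * (y * b - b * y) + (x * b - b * x) * y := by
        noncomm_ring
      rw [e]
      refine add_mem ?_ ?_
      · obtain ⟨c, hcc⟩ := Submodule.mem_one.1 (hc y hy b hb)
        rw [← hcc, ← Algebra.commutes, ← Algebra.smul_def]
        exact Submodule.smul_mem _ _ hx
      · rw [pow_succ]
        exact Submodule.mul_mem_mul (ih hx) hy
    | add x hx y hy h1 h2 =>
      have e : (x + y) * b - b * (x + y) = (x * b - b * x) + (y * b - b * y) := by noncomm_ring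
      rw [e]
      exact add_mem h1 h2

/-- The key step of Bernstein's inequality: an element of `B ^ m` that annihilates `B ^ m v` is
zero. -/
theorem eq_zero_of_pow_smul_eq_zero {B : Submodule k R} (h1 : (1 : R) ∈ B)
    (hc : ∀ a ∈ B, ∀ b ∈ B, a * b - b * a ∈ (1 : Submodule k R))
    (hz : ∀ a : R, (∀ b ∈ B, a * b = b * a) → a ∈ (1 : Submodule k R)) {v : M} (hv : v ≠ 0) (m : ℕ)
    {P : R} (hP : P ∈ B ^ m) (h : ∀ w ∈ B ^ m • Submodule.span k {v}, P • w = 0) : P = 0 := by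
  have mono : Monotone fun a : ℕ => B ^ a := pow_right_monotone (Submodule.one_le.2 h1)
  -- A scalar that kills v ≠ 0 is zero, and v itself lies in B^m v because 1 ∈ B.
  have scal : ∀ m, ∀ P ∈ (1 : Submodule k R),
      (∀ w ∈ B ^ m • Submodule.span k {v}, P • w = 0) → P = 0 := by
    intro m P hP h
    obtain ⟨c, rfl⟩ := Submodule.mem_one.1 hP
    have hv1 : v ∈ B ^ m • Submodule.span k {v} := by
      have := Submodule.smul_mem_smul (one_mem_pow h1 m)
        (Submodule.mem_span_singleton_self (R := k) v)
      rwa [one_smul] at this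
    have := h v hv1
    rw [algebraMap_smul, smul_eq_zero] at this
    rw [this.resolve_right hv, map_zero]
  induction m generalizing P with
  | zero => exact scal 0 P (by rwa [pow_zero] at hP) h
  | succ m ih =>
    -- It is enough that P commutes with every b ∈ B. The bracket [P, b] lies in B^m and kills B^m
    -- v, because both b B^m v and B^m v lie in B^(m+1) v; by induction it vanishes.
    refine scal (m + 1) P (hz P fun b hb => ?_) h
    rw [← sub_eq_zero]
    refine ih (commutator_mem_pow hc m hP hb) fun w hw => ?_
    rw [sub_smul, mul_smul, mul_smul, h w, smul_zero, sub_zero, h]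
    · rw [pow_succ', ← smul_eq_mul, Submodule.smul_assoc]
      exact Submodule.smul_mem_smul hb hw
    · exact Submodule.smul_mono_left (mono m.le_succ) hw

/-- Bernstein's inequality for the filtration `B ^ m`. -/
theorem finrank_pow_le_sq {B : Submodule k R} [FiniteDimensional k B] (h1 : (1 : R) ∈ B)
    (hc : ∀ a ∈ B, ∀ b ∈ B, a * b - b * a ∈ (1 : Submodule k R))
    (hz : ∀ a : R, (∀ b ∈ B, a * b = b * a) → a ∈ (1 : Submodule k R)) {v : M} (hv : v ≠ 0)
    (m : ℕ) :
    Module.finrank k (B ^ m : Submodule k R) ≤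
      Module.finrank k (B ^ (2 * m) • Submodule.span k {v} : Submodule k M) ^ 2 := by
  have mono : Monotone fun a : ℕ => B ^ a := pow_right_monotone (Submodule.one_le.2 h1)
  have f1 := finiteDimensional_pow B m
  have f2 := finiteDimensional_pow_smul B (Submodule.span k {v}) m
  have f3 := finiteDimensional_pow_smul B (Submodule.span k {v}) (2 * m)
  let W := B ^ m • Submodule.span k {v}
  let W' := B ^ (2 * m) • Submodule.span k {v}
  have hW : W ≤ W' := Submodule.smul_mono_left (mono (by omega))
  have hmem : ∀ (P : (B ^ m : Submodule k R)) (w : W), (P : R) • (w : M) ∈ W' := fun P w => by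
    change _ ∈ B ^ (2 * m) • _
    rw [two_mul, pow_add, ← smul_eq_mul, Submodule.smul_assoc]
    exact Submodule.smul_mem_smul P.2 w.2
  -- Action of B^m as linear maps from B^m v to B^(2m) v. Faithfulness bounds dim B^m by the product
  -- of the two dimensions.
  let φ : (B ^ m : Submodule k R) →ₗ[k] W →ₗ[k] W' :=
    LinearMap.mk₂ k (fun P w => ⟨(P : R) • (w : M), hmem P w⟩)
      (fun a b w => Subtype.ext (add_smul _ _ _))
      (fun c a w => Subtype.ext (smul_assoc _ _ _))
      (fun a w w' => Subtype.ext (smul_add _ _ _))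
      (fun c a w => Subtype.ext (by
        change (a : R) • (c • (w : M)) = c • ((a : R) • (w : M))
        rw [← algebraMap_smul R c, ← algebraMap_smul R c, ← mul_smul, ← mul_smul,
          Algebra.commutes]))
  have hφ : Function.Injective φ := by
    rw [injective_iff_map_eq_zero]
    intro P hP
    refine Subtype.ext (eq_zero_of_pow_smul_eq_zero h1 hc hz hv m P.2 fun w hw => ?_)
    exact congrArg Subtype.val (LinearMap.congr_fun hP ⟨w, hw⟩)
  calc _ ≤ Module.finrank k (W →ₗ[k] W') := LinearMap.finrank_le_finrank_of_injective hφ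
    _ = Module.finrank k W * Module.finrank k W' := Module.finrank_linearMap ..
    _ ≤ _ := by
      rw [sq]
      exact Nat.mul_le_mul_right _ (Submodule.finrank_mono hW)

end GK

/-! ### The chain of D-submodules generated by C^j M₀ -/

section Chain
variable {k : Type*} [Field k] {D : Type*} [Ring D] [Algebra k D] {R : Type*} [Ring R]
  [Algebra k R] {M : Type*} [AddCommGroup M] [Module k M] [Module R M] [IsScalarTower k R M]
  [Module D M] [IsScalarTower k D M]

/-- One stall is enough: e ∈ E commutes with ψ(D), so e(dw) = d(ew), and stability under E need only
be checked on C^j M₀, where it is the hypothesis. A subspace stable under ψ(B) and E is stable under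
the algebra they generate. -/
theorem span_pow_smul_eq_top (ψ : D →ₐ[k] R) (hψ : ∀ (d : D) (v : M), ψ d • v = d • v)
    {B : Submodule k D} {E : Submodule k R} (hE : ∀ e ∈ E, ∀ d, e * ψ d = ψ d * e)
    {M₀ : Submodule k M} (h : IsGeneratingPair k (B.map ψ.toLinearMap ⊔ E) M₀) (j : ℕ)
    (hj : (B.map ψ.toLinearMap ⊔ E) ^ (j + 1) • M₀ ≤
      (Submodule.span D (((B.map ψ.toLinearMap ⊔ E) ^ j • M₀ : Submodule k M) :
        Set M)).restrictScalars k) :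
    Submodule.span D (((B.map ψ.toLinearMap ⊔ E) ^ j • M₀ : Submodule k M) : Set M) = ⊤ := by
  set C := B.map ψ.toLinearMap ⊔ E with hC
  set N := Submodule.span D ((C ^ j • M₀ : Submodule k M) : Set M) with hN
  have hEN : ∀ e ∈ E, ∀ w ∈ N, e • w ∈ N := by
    intro e he w hw
    induction hw using Submodule.span_induction with
    | mem x hx =>
      refine hj ?_
      rw [pow_succ', ← smul_eq_mul, Submodule.smul_assoc]
      exact Submodule.smul_mem_smul (hC ▸ Submodule.mem_sup_right he) hx
    | zero => rw [smul_zero]; exact zero_mem _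
    | add x y _ _ hx hy => rw [smul_add]; exact add_mem hx hy
    | smul d x _ hx =>
      rw [← hψ, ← mul_smul, hE e he, mul_smul, hψ]
      exact N.smul_mem d hx
  have hCN : ∀ c ∈ C, ∀ w ∈ N, c • w ∈ N := by
    intro c hc w hw
    obtain ⟨_, ⟨b, hb, rfl⟩, e, he, rfl⟩ := Submodule.mem_sup.1 (hC ▸ hc)
    rw [add_smul]
    refine add_mem ?_ (hEN e he w hw)
    change ψ b • w ∈ N
    rw [hψ]
    exact N.smul_mem b hw
  have hkN : ∀ (c : k), ∀ w ∈ N, c • w ∈ N := fun c w hw => by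
    rw [← algebraMap_smul D c]
    exact N.smul_mem _ hw
  have hRN : ∀ (r : R), ∀ w ∈ N, r • w ∈ N := by
    intro r
    have hr : r ∈ Algebra.adjoin k (C : Set R) := by rw [h.adjoin_eq_top]; trivial
    induction hr using Algebra.adjoin_induction with
    | mem x hx => exact hCN x hx
    | algebraMap c =>
      intro w hw
      rw [algebraMap_smul]
      exact hkN c w hw
    | add x y _ _ hx hy =>
      intro w hw
      rw [add_smul]
      exact add_mem (hx w hw) (hy w hw)
    | mul x y _ _ hx hy =>
      intro w hw
      rw [mul_smul]
      exact hx _ (hy w hw)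
  have h0 : ∀ v ∈ M₀, v ∈ N := fun v hv => by
    refine Submodule.subset_span ?_
    have := Submodule.smul_mem_smul (one_mem_pow h.one_mem j) hv
    rwa [one_smul] at this
  refine eq_top_iff.2 fun v _ => ?_
  have hv : v ∈ Submodule.span R (M₀ : Set M) := by rw [h.span_eq_top]; trivial
  induction hv using Submodule.span_induction with
  | mem x hx => exact h0 x hx
  | zero => exact zero_mem _
  | add x y _ _ hx hy => exact add_mem (hx trivial) (hy trivial)
  | smul r x _ hx => exact hRN r x (hx trivial)

theorem pow_smul_le (ψ : D →ₐ[k] R) (hψ : ∀ (d : D) (v : M), ψ d • v = d • v)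
    {B : Submodule k D} {C : Submodule k R} (hBC : B.map ψ.toLinearMap ≤ C) (M₀ : Submodule k M)
    (m : ℕ) : B ^ m • M₀ ≤ C ^ m • M₀ := by
  refine Submodule.smul_le.2 fun d hd v hv => ?_
  rw [← hψ]
  refine Submodule.smul_mem_smul ?_ hv
  have h1 : ψ d ∈ (B ^ m).map ψ.toLinearMap := ⟨d, hd, rfl⟩
  rw [Submodule.map_pow] at h1
  exact pow_le_pow_left' hBC m h1

/-- Rank-nullity for W' → M/N: the kernel contains W and the range contains the image of V. -/
theorem finrank_add_le_of_map_mkQ {N : Submodule k M} {W W' V : Submodule k M}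
    [FiniteDimensional k W'] (hWN : W ≤ N) (hWW' : W ≤ W') (hV : V ≤ W') :
    Module.finrank k W + Module.finrank k (V.map N.mkQ) ≤ Module.finrank k W' := by
  let f : W' →ₗ[k] M ⧸ N := N.mkQ.comp W'.subtype
  have h1 := LinearMap.finrank_range_add_finrank_ker f
  have h2 : Module.finrank k (V.map N.mkQ) ≤ Module.finrank k (LinearMap.range f) := by
    refine Submodule.finrank_mono ?_
    rintro _ ⟨v, hv, rfl⟩
    exact ⟨⟨v, hV hv⟩, rfl⟩
  have h3 : Module.finrank k W ≤ Module.finrank k (LinearMap.ker f) := by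
    let g : W →ₗ[k] LinearMap.ker f := (Submodule.inclusion hWW').codRestrict _ fun w => by
      rw [LinearMap.mem_ker]
      exact (Submodule.Quotient.mk_eq_zero N).2 (hWN w.2)
    refine LinearMap.finrank_le_finrank_of_injective (f := g) fun a b hab => ?_
    have := congrArg (fun x : LinearMap.ker f => ((x : W') : M)) hab
    exact Subtype.ext this
  omega

/-- If the chain of `D`-submodules generated by `C ^ j M₀` is strictly increasing, then a uniform
lower bound on the growth of cyclic `D`-modules makes `C ^ m M₀` grow faster by one degree. -/
theorem mul_le_finrank_of_strict {n K : ℕ} {B : Submodule k D} [FiniteDimensional k B]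
    {C : Submodule k R} {M₀ : Submodule k M} [FiniteDimensional k C] [FiniteDimensional k M₀]
    (hC1 : (1 : R) ∈ C)
    (hbound : ∀ (N : Submodule D M) (v : M ⧸ N), v ≠ 0 → ∀ q : ℕ,
      q ^ n ≤ Module.finrank k (B ^ (K * q) • Submodule.span k {v} : Submodule k (M ⧸ N)))
    (hstrict : ∀ j, ¬ C ^ (j + 1) • M₀ ≤
      (Submodule.span D ((C ^ j • M₀ : Submodule k M) : Set M)).restrictScalars k) (q J : ℕ) :
    J * q ^ n ≤ Module.finrank k (B ^ (K * q) • (C ^ J • M₀) : Submodule k M) := by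
  have mono : Monotone fun a : ℕ => C ^ a := pow_right_monotone (Submodule.one_le.2 hC1)
  have fin : ∀ J, FiniteDimensional k (B ^ (K * q) • (C ^ J • M₀) : Submodule k M) := fun J =>
    have := finiteDimensional_pow_smul C M₀ J
    finiteDimensional_pow_smul _ _ _
  induction J with
  | zero => simp
  | succ J ih =>
    -- A vector v of C^(J+1) M₀ outside N has a nonzero class in M/N. The growth of its cyclic
    -- D-module there is new dimension, since B^(Kq) C^J M₀ already lies in N.
    obtain ⟨v, hv, hvN⟩ := Set.not_subset.1 (hstrict J)
    set N := Submodule.span D ((C ^ J • M₀ : Submodule k M) : Set M) with hN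
    have hv0 : (Submodule.Quotient.mk v : M ⧸ N) ≠ 0 := fun h0 =>
      hvN ((Submodule.Quotient.mk_eq_zero N).1 h0)
    have h1 := hbound N _ hv0 q
    have := fin (J + 1)
    have h2 := finrank_add_le_of_map_mkQ (N := N.restrictScalars k)
      (W := B ^ (K * q) • (C ^ J • M₀)) (W' := B ^ (K * q) • (C ^ (J + 1) • M₀))
      (V := B ^ (K * q) • Submodule.span k {v})
      (Submodule.smul_le.2 fun d _ w hw => N.smul_mem d (Submodule.subset_span hw))
      (Submodule.smul_mono le_rfl (Submodule.smul_mono_left (mono J.le_succ)))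
      (Submodule.smul_mono le_rfl ((Submodule.span_singleton_le_iff_mem _ _).2 hv))
    have h3 : Module.finrank k
        (B ^ (K * q) • Submodule.span k {Submodule.Quotient.mk v} : Submodule k (M ⧸ N)) ≤
        Module.finrank k ((B ^ (K * q) • Submodule.span k {v} : Submodule k M).map
          (N.restrictScalars k).mkQ) := by
      have fd : FiniteDimensional k (B ^ (K * q) • Submodule.span k {v} : Submodule k M) :=
        finiteDimensional_pow_smul _ _ _
      have hle : (B ^ (K * q) • Submodule.span k {Submodule.Quotient.mk v} :
          Submodule k (M ⧸ N)) ≤ (B ^ (K * q) • Submodule.span k {v} : Submodule k M).map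
            (N.mkQ.restrictScalars k) := by
        refine Submodule.smul_le.2 fun d hd w hw => ?_
        obtain ⟨c, rfl⟩ := Submodule.mem_span_singleton.1 hw
        exact ⟨d • (c • v), Submodule.smul_mem_smul hd
          (Submodule.smul_mem _ _ (Submodule.mem_span_singleton_self v)), rfl⟩
      exact (Submodule.finrank_mono hle).trans_eq rfl
    rw [add_mul, one_mul]
    omega

/-- The whole argument for an abstract D: the Weyl algebra enters only through the lower growth
bounds for cyclic submodules of M and of its quotients. -/
theorem isHolonomic_of_commuting {n K : ℕ} (hK : 0 < K) {B : Submodule k D}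
    [FiniteDimensional k B] (hB1 : (1 : D) ∈ B) (hBtop : Algebra.adjoin k (B : Set D) = ⊤)
    (hbound : ∀ (N : Submodule D M) (v : M ⧸ N), v ≠ 0 → ∀ q : ℕ,
      q ^ n ≤ Module.finrank k (B ^ (K * q) • Submodule.span k {v} : Submodule k (M ⧸ N)))
    (hbound' : ∀ v : M, v ≠ 0 → ∀ q : ℕ,
      q ^ n ≤ Module.finrank k (B ^ (K * q) • Submodule.span k {v} : Submodule k M))
    (ψ : D →ₐ[k] R) (hψ : ∀ (d : D) (v : M), ψ d • v = d • v)
    {E : Submodule k R} (hE : ∀ e ∈ E, ∀ d, e * ψ d = ψ d * e)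
    {M₀ : Submodule k M} (h : IsGeneratingPair k (B.map ψ.toLinearMap ⊔ E) M₀) [Nontrivial M]
    (hgk : gkDim k R M = n) : IsHolonomic k D M n := by
  set C := B.map ψ.toLinearMap ⊔ E with hC
  have hBC : B.map ψ.toLinearMap ≤ C := le_sup_left
  have := h.finite_left
  have := h.finite_right
  obtain ⟨j, hj⟩ : ∃ j, C ^ (j + 1) • M₀ ≤
      (Submodule.span D ((C ^ j • M₀ : Submodule k M) : Set M)).restrictScalars k := by
    by_contra! hstrict
    have hle : ((n + 1 : ℕ) : EReal) ≤ growth k C M₀ := by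
      -- Take J = q steps of the chain: B^(Kq) C^q M₀ ⊆ C^((K+1)q) M₀ has dimension at least q ·
      -- q^n.
      refine le_growth_of_le_finrank (K := K + 1) (by omega) fun q => ?_
      have h1 := mul_le_finrank_of_strict h.one_mem hbound hstrict q q
      have := finiteDimensional_pow_smul C M₀ ((K + 1) * q)
      rw [pow_succ']
      refine h1.trans (Submodule.finrank_mono ?_)
      refine (pow_smul_le ψ hψ hBC _ _).trans_eq ?_
      rw [← Submodule.smul_assoc, smul_eq_mul, ← pow_add, add_mul, one_mul]
    rw [← gkDim_eq h, hgk] at hle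
    have : n + 1 ≤ n := by exact_mod_cast hle
    omega
  have htop := span_pow_smul_eq_top ψ hψ hE h j hj
  have f1 := finiteDimensional_pow_smul C M₀ j
  have hpair : IsGeneratingPair k B (C ^ j • M₀) := ⟨‹_›, hB1, hBtop, f1, htop⟩
  have hspan : Submodule.span R ((C ^ j • M₀ : Submodule k M) : Set M) = ⊤ := by
    refine eq_top_iff.2 (h.span_eq_top ▸ Submodule.span_mono ?_)
    intro v hv
    have := Submodule.smul_mem_smul (one_mem_pow h.one_mem j) hv
    rwa [one_smul] at this
  have hpair' : IsGeneratingPair k C (C ^ j • M₀) :=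
    ⟨h.finite_left, h.one_mem, h.adjoin_eq_top, f1, hspan⟩
  refine ⟨⟨?_⟩, Or.inr (le_antisymm ?_ ?_)⟩
  · obtain ⟨S, hS⟩ := (Module.Finite.iff_fg.1 f1 : (C ^ j • M₀ : Submodule k M).FG)
    refine ⟨S, eq_top_iff.2 (htop ▸ Submodule.span_le.2 ?_)⟩
    rw [← hS]
    exact Submodule.span_subset_span k D _
  -- Over R the dimension may also be computed from C^j M₀, so the two growth functions start from
  -- the same space and compare termwise.
  · rw [gkDim_eq hpair, ← hgk, gkDim_eq hpair']
    refine Filter.limsup_le_limsup ?_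
    filter_upwards [Filter.eventually_ge_atTop 2] with m hm
    have := finiteDimensional_pow_smul C (C ^ j • M₀) m
    have hle := Submodule.finrank_mono (pow_smul_le ψ hψ hBC (C ^ j • M₀) m)
    rw [EReal.coe_le_coe_iff, Real.logb, Real.logb]
    refine div_le_div_of_nonneg_right ?_ (Real.log_natCast_nonneg _)
    -- Dimension zero is separate because `Real.log 0 = 0` is a default value.
    rcases Nat.eq_zero_or_pos (Module.finrank k (B ^ m • (C ^ j • M₀) : Submodule k M)) with h0 | h0
    · rw [h0, Nat.cast_zero, Real.log_zero]
      exact Real.log_natCast_nonneg _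
    · exact Real.log_le_log (by exact_mod_cast h0) (by exact_mod_cast hle)
  · rw [gkDim_eq hpair]
    -- Since M ≠ 0 is generated by C^j M₀, that space has a nonzero vector, and its cyclic module
    -- already grows fast enough.
    obtain ⟨v, hv, hv0⟩ : ∃ v ∈ (C ^ j • M₀ : Submodule k M), v ≠ 0 := by
      refine (Submodule.ne_bot_iff _).1 fun h0 => ?_
      rw [h0, Submodule.bot_coe, Submodule.span_singleton_eq_bot.2 rfl] at htop
      exact bot_ne_top htop
    refine le_growth_of_le_finrank hK fun q => (hbound' v hv0 q).trans ?_
    have := finiteDimensional_pow_smul B (C ^ j • M₀) (K * q)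
    exact Submodule.finrank_mono
      (Submodule.smul_mono le_rfl ((Submodule.span_singleton_le_iff_mem _ _).2 hv))

end Chain

/-! ### Extracting finitely many generators -/

section Generation

variable {k : Type*} [Field k] {R : Type*} [Ring R] [Algebra k R]

/-- A noncommutative polynomial in generators involves only finitely many of them. -/
theorem exists_finset_mem_adjoin (S Z : Set R) {r : R} (hr : r ∈ Algebra.adjoin k (S ∪ Z)) :
    ∃ T : Finset R, (T : Set R) ⊆ Z ∧ r ∈ Algebra.adjoin k (S ∪ (T : Set R)) := by
  classical
  have mono : ∀ T T' : Finset R, T ⊆ T' →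
      Algebra.adjoin k (S ∪ (T : Set R)) ≤ Algebra.adjoin k (S ∪ (T' : Set R)) := fun T T' h =>
    Algebra.adjoin_mono (Set.union_subset_union_right S (Finset.coe_subset.2 h))
  induction hr using Algebra.adjoin_induction with
  | mem x hx =>
    rcases hx with hx | hx
    · exact ⟨∅, by simp, Algebra.subset_adjoin (Or.inl hx)⟩
    · exact ⟨{x}, by simpa using hx, Algebra.subset_adjoin (Or.inr (by simp))⟩
  | algebraMap c => exact ⟨∅, by simp, Subalgebra.algebraMap_mem _ c⟩
  | add x y _ _ hx hy =>
    obtain ⟨T, hT, h⟩ := hx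
    obtain ⟨T', hT', h'⟩ := hy
    exact ⟨T ∪ T', by simp [hT, hT'], add_mem (mono _ _ Finset.subset_union_left h)
      (mono _ _ Finset.subset_union_right h')⟩
  | mul x y _ _ hx hy =>
    obtain ⟨T, hT, h⟩ := hx
    obtain ⟨T', hT', h'⟩ := hy
    exact ⟨T ∪ T', by simp [hT, hT'], mul_mem (mono _ _ Finset.subset_union_left h)
      (mono _ _ Finset.subset_union_right h')⟩

/-- If `S ∪ Z` generates the finitely generated algebra `R`, then `S` together with a
finite subset of `Z` generates `R`. -/
theorem exists_finset_adjoin_eq_top {S Z : Set R} (h : Algebra.adjoin k (S ∪ Z) = ⊤)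
    {C : Submodule k R} [FiniteDimensional k C] (hC : Algebra.adjoin k (C : Set R) = ⊤) :
    ∃ T : Finset R, (T : Set R) ⊆ Z ∧ Algebra.adjoin k (S ∪ (T : Set R)) = ⊤ := by
  classical
  obtain ⟨G, hG⟩ := (Module.Finite.iff_fg.1 ‹FiniteDimensional k C› : C.FG)
  choose T hTZ hT using fun r : R =>
    exists_finset_mem_adjoin (k := k) S Z (r := r) (by rw [h]; trivial)
  refine ⟨G.biUnion T, by simpa using fun i _ => hTZ i, ?_⟩
  rw [eq_top_iff, ← hC, ← hG, Algebra.adjoin_span]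
  refine Algebra.adjoin_le fun r hr => Algebra.adjoin_mono ?_ (hT r)
  exact Set.union_subset_union_right S
    (Finset.coe_subset.2 (Finset.subset_biUnion_of_mem T hr))

end Generation

/-! ### Bernstein's inequality from the Weyl relations -/

section GenSpan

variable (k : Type*) [Field k] {R : Type*} [Ring R] [Algebra k R] {n : ℕ}

/-- The span of `1`, the `x i` and the `d i`. -/
def genSpan (x d : Fin n → R) : Submodule k R :=
  Submodule.span k ({1} ∪ Set.range x ∪ Set.range d)

instance (x d : Fin n → R) : FiniteDimensional k (genSpan k x d) :=
  FiniteDimensional.span_of_finite k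
    (((Set.finite_singleton 1).union (Set.finite_range _)).union (Set.finite_range _))

variable {k} {x d : Fin n → R}

theorem one_mem_genSpan : (1 : R) ∈ genSpan k x d :=
  Submodule.subset_span (Or.inl (Or.inl rfl))

theorem left_mem_genSpan (i : Fin n) : x i ∈ genSpan k x d :=
  Submodule.subset_span (Or.inl (Or.inr ⟨i, rfl⟩))

theorem right_mem_genSpan (i : Fin n) : d i ∈ genSpan k x d :=
  Submodule.subset_span (Or.inr ⟨i, rfl⟩)

theorem genSpan_commutator (hxx : ∀ i j, x i * x j = x j * x i) (hdd : ∀ i j, d i * d j = d j * d i)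
    (hdx : ∀ i j, d i * x j - x j * d i ∈ (1 : Submodule k R)) (a : R) (ha : a ∈ genSpan k x d)
    (b : R) (hb : b ∈ genSpan k x d) : a * b - b * a ∈ (1 : Submodule k R) := by
  have key : ∀ a ∈ {1} ∪ Set.range x ∪ Set.range d, ∀ b ∈ {1} ∪ Set.range x ∪ Set.range d,
      a * b - b * a ∈ (1 : Submodule k R) := by
    rintro a ((rfl | ⟨i, rfl⟩) | ⟨i, rfl⟩) b ((rfl | ⟨j, rfl⟩) | ⟨j, rfl⟩)
    any_goals simp only [one_mul, mul_one, sub_self, zero_mem]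
    · rw [hxx, sub_self]
      exact zero_mem _
    · rw [← neg_sub]
      exact neg_mem (hdx j i)
    · exact hdx i j
    · rw [hdd, sub_self]
      exact zero_mem _
  induction ha, hb using Submodule.span_induction₂ with
  | mem_mem x y hx hy => exact key x hx y hy
  | zero_left y hy => rw [zero_mul, mul_zero, sub_self]; exact zero_mem _
  | zero_right y hy => rw [zero_mul, mul_zero, sub_self]; exact zero_mem _
  | add_left x y z _ _ _ h1 h2 =>
    have e : (x + y) * z - z * (x + y) = (x * z - z * x) + (y * z - z * y) := by noncomm_ring
    exact e ▸ add_mem h1 h2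
  | add_right x y z _ _ _ h1 h2 =>
    have e : x * (y + z) - (y + z) * x = (x * y - y * x) + (x * z - z * x) := by noncomm_ring
    exact e ▸ add_mem h1 h2
  | smul_left c x y _ _ h =>
    rw [smul_mul_assoc, mul_smul_comm, ← smul_sub]
    exact Submodule.smul_mem _ _ h
  | smul_right c x y _ _ h =>
    rw [smul_mul_assoc, mul_smul_comm, ← smul_sub]
    exact Submodule.smul_mem _ _ h

theorem list_prod_pow_mem {B : Submodule k R}
    (h1 : (1 : R) ∈ B) {q : ℕ} : ∀ {m : ℕ} (a : Fin m → R), (∀ i, a i ∈ B) → ∀ s : Fin m → ℕ,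
    (∀ i, s i ≤ q) → (List.ofFn fun i => a i ^ s i).prod ∈ B ^ (m * q)
  | 0, _, _, _, _ => by simpa using one_mem_pow h1 0
  | m + 1, a, ha, s, hs => by
    rw [List.ofFn_succ, List.prod_cons, add_mul, one_mul, add_comm, pow_add]
    refine Submodule.mul_mem_mul ?_ (list_prod_pow_mem h1 _ (fun i => ha i.succ) _
      (fun i => hs i.succ))
    exact pow_right_monotone (Submodule.one_le.2 h1) (hs 0) (Submodule.pow_mem_pow _ (ha 0) _)

/-- Count the monomials whose 2n exponents are all less than q: there are q^(2n) of them, each a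
product of two factors in the power nq of the generating space. -/
theorem pow_le_finrank_genSpan_pow (hli : LinearIndependent k
      fun p : (Fin n → ℕ) × (Fin n → ℕ) =>
        (List.ofFn fun i => x i ^ p.1 i).prod * (List.ofFn fun i => d i ^ p.2 i).prod) (q : ℕ) :
    (q ^ n) ^ 2 ≤ Module.finrank k (genSpan k x d ^ (2 * n * q) : Submodule k R) := by
  have hw : ∀ p : (Fin n → Fin q) × (Fin n → Fin q),
      (List.ofFn fun i => x i ^ (p.1 i : ℕ)).prod * (List.ofFn fun i => d i ^ (p.2 i : ℕ)).prod ∈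
        genSpan k x d ^ (2 * n * q) := fun p => by
    rw [mul_assoc, two_mul, pow_add]
    exact Submodule.mul_mem_mul
      (list_prod_pow_mem one_mem_genSpan _ left_mem_genSpan _ fun i => (p.1 i).2.le)
      (list_prod_pow_mem one_mem_genSpan _ right_mem_genSpan _ fun i => (p.2 i).2.le)
  have hli' : LinearIndependent k (fun p =>
      (⟨_, hw p⟩ : (genSpan k x d ^ (2 * n * q) : Submodule k R))) := by
    refine LinearIndependent.of_comp (Submodule.subtype _) (hli.comp
      (fun p : (Fin n → Fin q) × (Fin n → Fin q) =>
        ((fun i => (p.1 i : ℕ)), (fun i => (p.2 i : ℕ)))) ?_)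
    rintro ⟨a, b⟩ ⟨c, e⟩ h
    rw [Prod.mk.injEq] at h
    exact Prod.ext (funext fun i => Fin.ext (congrFun h.1 i))
      (funext fun i => Fin.ext (congrFun h.2 i))
  have := finiteDimensional_pow (genSpan k x d) (2 * n * q)
  simpa [sq] using hli'.fintype_card_le_finrank

/-- Bernstein's inequality for an algebra generated by `x i` and `d i` subject to the relations of
the Weyl algebra. -/
theorem pow_le_finrank_genSpan_pow_smul (hxx : ∀ i j, x i * x j = x j * x i)
    (hdd : ∀ i j, d i * d j = d j * d i)
    (hdx : ∀ i j, d i * x j - x j * d i ∈ (1 : Submodule k R))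
    (hz : ∀ a : R, (∀ b ∈ genSpan k x d, a * b = b * a) → a ∈ (1 : Submodule k R))
    (hli : LinearIndependent k fun p : (Fin n → ℕ) × (Fin n → ℕ) =>
        (List.ofFn fun i => x i ^ p.1 i).prod * (List.ofFn fun i => d i ^ p.2 i).prod)
    {M : Type*} [AddCommGroup M] [Module k M] [Module R M] [IsScalarTower k R M] {v : M}
    (hv : v ≠ 0) (q : ℕ) :
    q ^ n ≤ Module.finrank k
      (genSpan k x d ^ ((4 * n + 1) * q) • Submodule.span k {v} : Submodule k M) := by
  have h1 := (pow_le_finrank_genSpan_pow hli q).trans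
    (finrank_pow_le_sq one_mem_genSpan (genSpan_commutator hxx hdd hdx) hz hv (2 * n * q))
  -- Taking square roots leaves the exponent 2 · 2nq = 4nq. The constant 4n + 1 replaces 4n so that
  -- it stays positive when n = 0.
  refine ((Nat.pow_le_pow_iff_left two_ne_zero).1 h1).trans ?_
  have := finiteDimensional_pow_smul (genSpan k x d) (Submodule.span k {v}) ((4 * n + 1) * q)
  exact Submodule.finrank_mono (Submodule.smul_mono_left
    (pow_right_monotone (Submodule.one_le.2 one_mem_genSpan) (by nlinarith)))

end GenSpan
-- Center, generators and monomials of the Weyl algebra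
section WeylFiltration
open MvPolynomial

variable (k : Type*) [Field k] (n : ℕ)

/-- The span of `1`, the `xᵢ` and the `∂ᵢ` in the Weyl algebra. -/
abbrev weylGen := genSpan k (fun i => weylMul k n (X i)) (weylD k n)

variable {k n}

theorem weylMul_apply (f g : MvPolynomial (Fin n) k) :
    (weylMul k n f : Module.End k (MvPolynomial (Fin n) k)) g = f * g := rfl

theorem weylD_apply (i : Fin n) (g : MvPolynomial (Fin n) k) :
    (weylD k n i : Module.End k (MvPolynomial (Fin n) k)) g = pderiv i g := rfl

theorem weylMul_mul_weylMul (f g : MvPolynomial (Fin n) k) :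
    weylMul k n f * weylMul k n g = weylMul k n (f * g) :=
  Subtype.ext (map_mul (Algebra.lmul k (MvPolynomial (Fin n) k)) f g).symm

theorem weylMul_add (f g : MvPolynomial (Fin n) k) :
    weylMul k n (f + g) = weylMul k n f + weylMul k n g :=
  Subtype.ext (map_add (Algebra.lmul k (MvPolynomial (Fin n) k)) f g)

theorem weylMul_C (c : k) : weylMul k n (C c) = algebraMap k _ c :=
  Subtype.ext ((Algebra.lmul k (MvPolynomial (Fin n) k)).commutes c)

theorem pderiv_comm (i j : Fin n) (f : MvPolynomial (Fin n) k) :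
    pderiv i (pderiv j f) = pderiv j (pderiv i f) := by
  have h := congrArg (actUV k (MvPolynomial (Fin n) k)) (dU_comm k n i j)
  rw [map_mul, map_mul, dU, dU, actUV_vf, actUV_vf] at h
  exact LinearMap.congr_fun h f

/-- For m ≠ 0 some mᵢ is nonzero, and mᵢ times the coefficient of f at m is a coefficient of ∂ᵢf; in
characteristic 0 one can divide by mᵢ. -/
theorem exists_C_of_pderiv_eq_zero [CharZero k] (f : MvPolynomial (Fin n) k)
    (h : ∀ i, pderiv i f = 0) : ∃ c, f = C c := by
  refine ⟨coeff 0 f, MvPolynomial.ext _ _ fun m => ?_⟩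
  classical
  rw [coeff_C]
  split_ifs with hm
  · rw [hm]
  · obtain ⟨i, hi⟩ : ∃ i, m i ≠ 0 := by
      by_contra! h0
      exact hm (Finsupp.ext fun i => (h0 i).symm)
    have hle : Finsupp.single i 1 ≤ m := by rw [Finsupp.single_le_iff]; omega
    have h1 := coeff_pderiv f (m - Finsupp.single i 1) (i := i)
    rw [h i, coeff_zero, tsub_add_cancel_of_le hle] at h1
    refine (mul_eq_zero.1 h1.symm).resolve_right ?_
    exact Nat.cast_add_one_ne_zero _

/-- An operator commuting with the xᵢ is A-linear, hence multiplication by its value at 1; commuting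
with the ∂ᵢ makes that value constant. -/
theorem weylAlgebra_center [CharZero k] (a : WeylAlgebra k n)
    (h : ∀ b ∈ weylGen k n, a * b = b * a) : a ∈ (1 : Submodule k (WeylAlgebra k n)) := by
  have hx : ∀ i f, a.1 (X i * f) = X i * a.1 f := fun i f =>
    LinearMap.congr_fun (congrArg Subtype.val (h _ (left_mem_genSpan i))) f
  have hd : ∀ i f, a.1 (pderiv i f) = pderiv i (a.1 f) := fun i f =>
    LinearMap.congr_fun (congrArg Subtype.val (h _ (right_mem_genSpan i))) f
  have hf : ∀ f g, a.1 (f * g) = f * a.1 g := by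
    intro f
    induction f using MvPolynomial.induction_on with
    | C c => intro g; rw [← smul_eq_C_mul, ← smul_eq_C_mul, map_smul]
    | add p q hp hq => intro g; rw [add_mul, map_add, hp, hq, add_mul]
    | mul_X p i hp => intro g; rw [mul_assoc, hp, hx, mul_assoc]
  obtain ⟨c, hc⟩ := exists_C_of_pderiv_eq_zero (a.1 1) fun i => by
    rw [← hd, pderiv_one, map_zero]
  refine Submodule.mem_one.2 ⟨c, Subtype.ext (LinearMap.ext fun f => ?_)⟩
  have h1 := hf f 1
  rw [mul_one, hc, mul_comm, ← smul_eq_C_mul] at h1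
  exact h1.symm

theorem sum_derivation_apply
    (F : Fin n → Derivation k (MvPolynomial (Fin n) k) (MvPolynomial (Fin n) k))
    (a : MvPolynomial (Fin n) k) : (∑ i, F i) a = ∑ i, F i a :=
  (congrFun (map_sum Derivation.coeFnAddMonoidHom F Finset.univ) a).trans
    (Finset.sum_apply a Finset.univ _)

theorem derivation_eq_sum (η : Derivation k (MvPolynomial (Fin n) k) (MvPolynomial (Fin n) k)) :
    η = ∑ i, η (X i) • (pderiv i : Derivation k (MvPolynomial (Fin n) k) _) := by
  refine MvPolynomial.derivation_ext fun j => ?_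
  classical
  simp [sum_derivation_apply, pderiv_X, Pi.single_apply]

theorem weylMul_mem_adjoin (f : MvPolynomial (Fin n) k) :
    weylMul k n f ∈ Algebra.adjoin k (weylGen k n : Set (WeylAlgebra k n)) := by
  induction f using MvPolynomial.induction_on with
  | C c => rw [weylMul_C]; exact Subalgebra.algebraMap_mem _ c
  | add p q hp hq => rw [weylMul_add]; exact add_mem hp hq
  | mul_X p i hp =>
    rw [← weylMul_mul_weylMul]
    exact mul_mem hp (Algebra.subset_adjoin (left_mem_genSpan i))

/-- Every derivation is Σ η(xᵢ)∂ᵢ, so the finite set of coordinates and partials replaces all of A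
and Der(A). -/
theorem adjoin_weylGen : Algebra.adjoin k (weylGen k n : Set (WeylAlgebra k n)) = ⊤ := by
  have key : WeylAlgebra k n ≤
      (Algebra.adjoin k (weylGen k n : Set (WeylAlgebra k n))).map (WeylAlgebra k n).val := by
    refine Algebra.adjoin_le ?_
    rintro _ (⟨f, rfl⟩ | ⟨η, rfl⟩)
    · exact ⟨_, weylMul_mem_adjoin f, rfl⟩
    · refine ⟨∑ i, weylMul k n (η (X i)) * weylD k n i, sum_mem fun i _ =>
        mul_mem (weylMul_mem_adjoin _) (Algebra.subset_adjoin (right_mem_genSpan i)), ?_⟩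
      refine LinearMap.ext fun a => ?_
      conv_rhs => rw [derivation_eq_sum η]
      simp [sum_derivation_apply, weylMul_apply, weylD_apply]
  refine eq_top_iff.2 fun d _ => ?_
  obtain ⟨e, he, hed⟩ := key d.2
  exact Subtype.ext hed ▸ he

theorem weylD_mul_weylMul_X_sub (i j : Fin n) :
    weylD k n i * weylMul k n (X j) - weylMul k n (X j) * weylD k n i =
      algebraMap k _ (if i = j then 1 else 0) := by
  refine Subtype.ext (LinearMap.ext fun f => ?_)
  change pderiv i (X j * f) - X j * pderiv i f = (if i = j then 1 else 0 : k) • f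
  rw [Derivation.leibniz, pderiv_X]
  by_cases h : i = j
  · subst h; simp
  · simp [h, Ne.symm h]

theorem list_prod_weylMul (s : Fin n → ℕ) : (List.ofFn fun i => weylMul k n (X i) ^ s i).prod =
    weylMul k n (monomial (Finsupp.equivFunOnFinite.symm s) 1) := by
  refine Subtype.ext ?_
  change (WeylAlgebra k n).val _ = Algebra.lmul k _ _
  rw [monomial_eq, map_list_prod, List.map_ofFn, C_1, one_mul, Finsupp.prod_fintype _ _
    (fun i => pow_zero _), ← List.prod_ofFn, map_list_prod, List.map_ofFn]
  congr 2
  funext i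
  simp only [Function.comp_apply, map_pow]
  rfl

/-- The operators x^a ∂^b are the images of basis vectors of the space of normal forms, which acts
faithfully on A in characteristic 0. -/
theorem linearIndependent_weyl [CharZero k] : LinearIndependent k
    fun p : (Fin n → ℕ) × (Fin n → ℕ) => (List.ofFn fun i => weylMul k n (X i) ^ p.1 i).prod *
      (List.ofFn fun i => weylD k n i ^ p.2 i).prod := by
  let e : (Fin n → ℕ) ≃ (Fin n →₀ ℕ) := Finsupp.equivFunOnFinite.symm
  let F : ((Fin n →₀ ℕ) →₀ MvPolynomial (Fin n) k) →ₗ[k] Module.End k (MvPolynomial (Fin n) k) :=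
    (SmashProduct.toEnd k _).toLinearMap.comp (normalForm k n)
  have hF : LinearMap.ker F = ⊥ := LinearMap.ker_eq_bot'.2 toEnd_normalForm_injective
  have hb : LinearIndependent k (fun p : (Fin n → ℕ) × (Fin n → ℕ) =>
      Finsupp.single (e p.2) (monomial (e p.1) (1 : k))) := by
    have h := (Finsupp.basis (R := k) (fun _ : Fin n →₀ ℕ =>
      basisMonomials (Fin n) k)).linearIndependent
    have h2 := h.comp (fun p : (Fin n → ℕ) × (Fin n → ℕ) =>
      (⟨e p.2, e p.1⟩ : (_ : Fin n →₀ ℕ) × (Fin n →₀ ℕ))) (by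
        rintro ⟨a, b⟩ ⟨c, d⟩ h
        simp only [Sigma.mk.injEq, heq_eq_eq] at h
        rw [e.injective h.1, e.injective h.2])
    simpa [Function.comp_def] using h2
  refine LinearIndependent.of_comp (WeylAlgebra k n).val.toLinearMap ?_
  have h3 := hb.map' F hF
  suffices hFw : (F ∘ fun p => Finsupp.single (e p.2) (monomial (e p.1) (1 : k))) =
      ((WeylAlgebra k n).val.toLinearMap ∘ fun p : (Fin n → ℕ) × (Fin n → ℕ) =>
        (List.ofFn fun i => weylMul k n (X i) ^ p.1 i).prod *
          (List.ofFn fun i => weylD k n i ^ p.2 i).prod) by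
    rw [hFw] at h3
    exact h3
  symm
  funext p
  refine Eq.trans ?_ (b := SmashProduct.toEnd k _ (normalForm k n
    (Finsupp.single (e p.2) (monomial (e p.1) 1)))) rfl
  rw [Function.comp_apply, AlgHom.toLinearMap_apply]
  rw [normalForm_single, SmashProduct.toEnd_mk, map_mul, list_prod_weylMul, dPow, map_list_prod,
    map_list_prod, List.map_ofFn, List.map_ofFn]
  refine congrArg₂ _ rfl ?_
  congr 2
  funext i
  simp only [Function.comp_apply, map_pow, dU, actUV_vf]
  rfl

theorem weylMul_X_comm (i j : Fin n) :
    weylMul k n (X i) * weylMul k n (X j) = weylMul k n (X j) * weylMul k n (X i) := by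
  rw [weylMul_mul_weylMul, weylMul_mul_weylMul, mul_comm]

theorem weylD_comm (i j : Fin n) : weylD k n i * weylD k n j = weylD k n j * weylD k n i :=
  Subtype.ext (LinearMap.ext fun f => pderiv_comm i j f)

theorem weylD_mul_weylMul_X_sub_mem (i j : Fin n) :
    weylD k n i * weylMul k n (X j) - weylMul k n (X j) * weylD k n i ∈
      (1 : Submodule k (WeylAlgebra k n)) :=
  Submodule.mem_one.2 ⟨_, (weylD_mul_weylMul_X_sub i j).symm⟩

/-- Bernstein's inequality. -/
theorem pow_le_finrank_weylGen_pow_smul [CharZero k] {M : Type*} [AddCommGroup M] [Module k M]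
    [Module (WeylAlgebra k n) M] [IsScalarTower k (WeylAlgebra k n) M] {v : M} (hv : v ≠ 0)
    (q : ℕ) :
    q ^ n ≤ Module.finrank k
      (weylGen k n ^ ((4 * n + 1) * q) • Submodule.span k {v} : Submodule k M) := by
  refine pow_le_finrank_genSpan_pow_smul (R := WeylAlgebra k n) ?_ ?_ ?_ ?_ ?_ hv q
  · exact weylMul_X_comm
  · exact weylD_comm
  · exact weylD_mul_weylMul_X_sub_mem
  · exact weylAlgebra_center
  · exact linearIndependent_weyl

end WeylFiltration

attribute [local instance 100] LieRing.ofAssociativeRing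

/-! ### Elements of the smash product commuting with the Weyl algebra -/

section Centralizer
open MvPolynomial

variable {k : Type*} [Field k] {n : ℕ}

local notation "A" => MvPolynomial (Fin n) k

/-- The linear map `f ⊗ g ↦ f # g ∂ᵢ`. -/
def smulD (i : Fin n) : A ⊗[k] A →ₗ[k] AV k n :=
  TensorProduct.lift (LinearMap.mk₂ k
    (fun f g : A => (SmashProduct.mk k A f (vf k A (g • pderiv i)) : AV k n))
    (fun a b g => TensorProduct.add_tmul a b _)
    (fun c a g => rfl)
    (fun a g h => by rw [add_smul, map_add]; exact TensorProduct.tmul_add a _ _)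
    (fun c a g => by rw [smul_assoc, map_smul]; exact TensorProduct.tmul_smul c a _))

theorem smulD_tmul (i : Fin n) (f g : A) :
    smulD i (f ⊗ₜ g) = SmashProduct.mk k A f (vf k A (g • pderiv i)) := rfl

/-- The derivation `∂ⱼ ⊗ 1 + 1 ⊗ ∂ⱼ` of `A ⊗ A`. -/
def diagD (j : Fin n) : A ⊗[k] A →ₗ[k] A ⊗[k] A :=
  LinearMap.rTensor A (pderiv j : Derivation k A A).toLinearMap +
    LinearMap.lTensor A (pderiv j : Derivation k A A).toLinearMap

theorem diagD_tmul (j : Fin n) (f g : A) :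
    diagD j (f ⊗ₜ[k] g) = pderiv j f ⊗ₜ g + f ⊗ₜ pderiv j g := rfl

theorem diagD_mul (j : Fin n) (s t : A ⊗[k] A) :
    diagD j (s * t) = s * diagD j t + t * diagD j s := by
  induction s with
  | zero => simp
  | add a b ha hb => rw [add_mul, map_add, ha, hb, map_add]; ring
  | tmul f g =>
    induction t with
    | zero => simp
    | add a b ha hb => rw [mul_add, map_add, ha, hb, map_add]; ring
    | tmul p q =>
      simp only [Algebra.TensorProduct.tmul_mul_tmul, diagD_tmul, Derivation.leibniz, smul_eq_mul,
        mul_add, TensorProduct.add_tmul, TensorProduct.tmul_add]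
      rw [mul_comm p f, mul_comm q g]
      abel

variable (k n) in
/-- The algebra map `p ↦ p (1 ⊗ x - x ⊗ 1)`. -/
def diffHom : A →ₐ[k] A ⊗[k] A := aeval fun j => 1 ⊗ₜ X j - X j ⊗ₜ 1

/-- Translation invariance: the derivation ∂ⱼ ⊗ 1 + 1 ⊗ ∂ⱼ kills every difference 1 ⊗ xᵢ - xᵢ ⊗ 1.
-/
theorem diagD_diffHom (j : Fin n) (p : A) : diagD j (diffHom k n p) = 0 := by
  induction p using MvPolynomial.induction_on with
  | C c =>
    rw [← algebraMap_eq, AlgHom.commutes, Algebra.TensorProduct.algebraMap_apply, diagD_tmul,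
      algebraMap_eq, pderiv_C, pderiv_one, TensorProduct.zero_tmul, TensorProduct.tmul_zero,
      add_zero]
  | add p q hp hq => rw [map_add, map_add, hp, hq, add_zero]
  | mul_X p i hp =>
    classical
    rw [map_mul, diagD_mul, hp, mul_zero, add_zero, diffHom, aeval_X, map_sub, diagD_tmul,
      diagD_tmul, pderiv_one, TensorProduct.zero_tmul, TensorProduct.tmul_zero, pderiv_X]
    by_cases h : i = j
    · subst h; simp
    · simp [h]

/-- On the diagonal all differences vanish, leaving the constant p(0). -/
theorem lmul_diffHom (p : A) :
    Algebra.TensorProduct.lmul' k (diffHom k n p) = algebraMap k A (aeval (0 : Fin n → k) p) := by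
  have h : (Algebra.TensorProduct.lmul' k).comp (diffHom k n) =
      (Algebra.ofId k A).comp (aeval (0 : Fin n → k)) := by
    refine MvPolynomial.algHom_ext fun i => ?_
    simp [diffHom]
  exact DFunLike.congr_fun h p

/-- The change of coordinates (x, y) ↦ (x, y - x) is invertible: y is recovered as (y - x) + x. -/
theorem exists_lift_diffHom_eq (t : A ⊗[k] A) :
    ∃ s : A ⊗[k] A, Algebra.TensorProduct.lift
      (Algebra.TensorProduct.includeLeft : A →ₐ[k] A ⊗[k] A) (diffHom k n)
      (fun _ _ => Commute.all _ _) s = t := by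
  set θ := Algebra.TensorProduct.lift (Algebra.TensorProduct.includeLeft : A →ₐ[k] A ⊗[k] A)
    (diffHom k n) (fun _ _ => Commute.all _ _)
  change t ∈ θ.range
  have hl : ∀ f : A, f ⊗ₜ[k] (1 : A) ∈ θ.range := fun f => ⟨f ⊗ₜ 1, by simp [θ]⟩
  have hr : ∀ g : A, (1 : A) ⊗ₜ[k] g ∈ θ.range := by
    intro g
    induction g using MvPolynomial.induction_on with
    | C c =>
      rw [← algebraMap_eq, ← Algebra.TensorProduct.algebraMap_apply']
      exact Subalgebra.algebraMap_mem _ c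
    | add p q hp hq => rw [TensorProduct.tmul_add]; exact add_mem hp hq
    | mul_X p i hp =>
      have e : (1 : A) ⊗ₜ[k] (p * X i) = (1 ⊗ₜ p) * (diffHom k n (X i) + X i ⊗ₜ 1) := by
        simp [diffHom]
      rw [e]
      refine mul_mem hp (add_mem ⟨1 ⊗ₜ X i, ?_⟩ (hl _))
      exact (Algebra.TensorProduct.lift_tmul ..).trans (by rw [map_one, one_mul])
  induction t with
  | zero => exact zero_mem _
  | add a b ha hb => exact add_mem ha hb
  | tmul f g =>
    have e : f ⊗ₜ[k] g = (f ⊗ₜ 1) * (1 ⊗ₜ g) := by simp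
    rw [e]
    exact mul_mem (hl f) (hr g)

theorem mk_mul_smulD (i : Fin n) (f : A) (t : A ⊗[k] A) :
    (SmashProduct.mk k A f 1 : AV k n) * smulD i t = smulD i ((f ⊗ₜ 1) * t) := by
  induction t with
  | zero => rw [mul_zero, map_zero, mul_zero]
  | add a b ha hb => rw [map_add, mul_add, ha, hb, mul_add, map_add]
  | tmul p q =>
    rw [smulD_tmul, SmashProduct.mk_one_mul_mk, Algebra.TensorProduct.tmul_mul_tmul, one_mul,
      smulD_tmul]

/-- The vector field differentiates xⱼ to a function, so the obstruction to commuting with xⱼ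
depends only on the image of t under multiplication. -/
theorem smulD_mul_mk_X (i j : Fin n) (t : A ⊗[k] A) :
    smulD i t * (SmashProduct.mk k A (X j) 1 : AV k n) =
      SmashProduct.mk k A (X j) 1 * smulD i t +
        SmashProduct.mk k A (Algebra.TensorProduct.lmul' k t * pderiv i (X j)) 1 := by
  have mk_add : ∀ f g : A, (SmashProduct.mk k A (f + g) 1 : AV k n) =
    SmashProduct.mk k A f 1 + SmashProduct.mk k A g 1 := fun f g => TensorProduct.add_tmul f g _
  induction t with
  | zero =>
    rw [map_zero, map_zero, zero_mul, zero_mul, mul_zero, zero_add]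
    exact (TensorProduct.zero_tmul _ _).symm
  | add a b ha hb => rw [map_add, add_mul, ha, hb, mul_add, map_add, add_mul, mk_add]; abel
  | tmul p q =>
    rw [smulD_tmul, SmashProduct.mk_vf_mul_mk, SmashProduct.mk_one_mul_mk, mul_one,
      Algebra.TensorProduct.lmul'_apply_tmul, Derivation.smul_apply, smul_eq_mul, mul_comm p (X j),
      mul_assoc, add_comm]

/-- The Leibniz rule on f combines with [∂ⱼ, g∂ᵢ] = (∂ⱼg)∂ᵢ into the diagonal derivation. -/
theorem mk_dU_mul_smulD (i j : Fin n) (t : A ⊗[k] A) :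
    (SmashProduct.mk k A 1 (vf k A (pderiv j)) : AV k n) * smulD i t =
      smulD i t * SmashProduct.mk k A 1 (vf k A (pderiv j)) + smulD i (diagD j t) := by
  induction t with
  | zero => rw [map_zero, map_zero, map_zero, zero_mul, mul_zero, zero_add]
  | add a b ha hb => rw [map_add, mul_add, ha, hb, add_mul, map_add, map_add]; abel
  | tmul p q =>
    have hbr : ⁅(pderiv j : Derivation k A A), q • (pderiv i : Derivation k A A)⁆ =
        pderiv j q • (pderiv i : Derivation k A A) := by
      refine Derivation.ext fun f => ?_
      rw [Derivation.commutator_apply]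
      simp only [Derivation.smul_apply, smul_eq_mul, Derivation.leibniz]
      rw [pderiv_comm i j]
      ring
    have h := congrArg (vf k A) hbr
    rw [LieHom.map_lie, LieRing.of_associative_ring_bracket, sub_eq_iff_eq_add] at h
    rw [smulD_tmul, SmashProduct.mk_vf_mul_mk, mk_one_mul_mk_one, diagD_tmul, map_add, smulD_tmul,
      smulD_tmul, one_mul, one_mul, h]
    have mk_add : ∀ u v, (SmashProduct.mk k A p (u + v) : AV k n) =
      SmashProduct.mk k A p u + SmashProduct.mk k A p v := fun u v => TensorProduct.tmul_add p u v
    rw [mk_add]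
    abel

variable [CharZero k]

variable (k n) in
/-- The centralizer of the Weyl algebra in `A # U(V)`. -/
def weylCentralizer : Set (AV k n) := {z | ∀ d, z * weylToAV k n d = weylToAV k n d * z}

theorem mem_weylCentralizer {z : AV k n}
    (hx : ∀ j, z * SmashProduct.mk k A (X j) 1 = SmashProduct.mk k A (X j) 1 * z)
    (hd : ∀ j, z * SmashProduct.mk k A 1 (vf k A (pderiv j)) =
      SmashProduct.mk k A 1 (vf k A (pderiv j)) * z) : z ∈ weylCentralizer k n := by
  intro d
  have h : d ∈ Algebra.adjoin k (weylGen k n : Set (WeylAlgebra k n)) := by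
    rw [adjoin_weylGen]; trivial
  rw [weylGen, genSpan, Algebra.adjoin_span] at h
  induction h using Algebra.adjoin_induction with
  | mem x h =>
    rcases h with (rfl | ⟨j, rfl⟩) | ⟨j, rfl⟩
    · rw [map_one, one_mul, mul_one]
    · simp only [weylToAV_mul, hx]
    · rw [weylToAV_d, hd]
  | algebraMap c => rw [AlgHom.commutes, Algebra.commutes]
  | add x y _ _ h1 h2 => rw [map_add, mul_add, add_mul, h1, h2]
  | mul x y _ _ h1 h2 => rw [map_mul, ← mul_assoc, h1, mul_assoc, h2, mul_assoc]

/-- These are the fields p∂ᵢ vanishing at the origin, recentred at the moving point x. Vanishing at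
the origin kills the commutator with xⱼ; translation invariance kills the one with ∂ⱼ. -/
theorem smulD_diffHom_mem (i : Fin n) {p : A} (hp : aeval (0 : Fin n → k) p = 0) :
    smulD i (diffHom k n p) ∈ weylCentralizer k n := by
  refine mem_weylCentralizer (fun j => ?_) fun j => ?_
  · rw [smulD_mul_mk_X, lmul_diffHom, hp, map_zero, zero_mul]
    exact (congrArg _ (TensorProduct.zero_tmul _ _)).trans (add_zero _)
  · rw [mk_dU_mul_smulD, diagD_diffHom, map_zero, add_zero]

/-- The smash product is generated by the Weyl algebra and its centralizer. -/
theorem adjoin_weylGen_union_centralizer :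
    Algebra.adjoin k (weylToAV k n '' (weylGen k n : Set (WeylAlgebra k n)) ∪
      weylCentralizer k n) = ⊤ := by
  set S := Algebra.adjoin k (weylToAV k n '' (weylGen k n : Set (WeylAlgebra k n)) ∪
      weylCentralizer k n)
  have hψ : ∀ d, weylToAV k n d ∈ S := fun d => by
    have h : d ∈ Algebra.adjoin k (weylGen k n : Set (WeylAlgebra k n)) := by
      rw [adjoin_weylGen]; trivial
    have h2 : weylToAV k n d ∈
        (Algebra.adjoin k (weylGen k n : Set (WeylAlgebra k n))).map (weylToAV k n) := ⟨d, h, rfl⟩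
    rw [AlgHom.map_adjoin] at h2
    exact Algebra.adjoin_mono Set.subset_union_left h2
  have hf : ∀ f : A, (SmashProduct.mk k A f 1 : AV k n) ∈ S := fun f =>
    weylToAV_mul (k := k) f ▸ hψ _
  have hd : ∀ i : Fin n, (SmashProduct.mk k A 1 (vf k A (pderiv i)) : AV k n) ∈ S := fun i =>
    weylToAV_d (k := k) i ▸ hψ _
  -- Split off the constant term: p - p(0) gives a centralizing element, while p(0) contributes a
  -- multiple of 1 # ∂ᵢ, which is in ψ(D).
  have hδ : ∀ (i : Fin n) (p : A), smulD i (diffHom k n p) ∈ S := fun i p => by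
    have e : smulD i (diffHom k n p) =
        smulD i (diffHom k n (p - algebraMap k A (aeval (0 : Fin n → k) p))) +
          aeval (0 : Fin n → k) p • smulD i (1 ⊗ₜ 1) := by
      rw [← map_smul, ← map_add, map_sub, AlgHom.commutes, ← Algebra.TensorProduct.one_def,
        ← Algebra.algebraMap_eq_smul_one, sub_add_cancel]
    rw [e]
    refine add_mem (Algebra.subset_adjoin (Or.inr (smulD_diffHom_mem i ?_)))
      (Subalgebra.smul_mem _ ?_ _)
    · rw [map_sub, AlgHom.commutes]
      exact sub_self _
    · rw [smulD_tmul, one_smul]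
      exact hd i
  have hΦ : ∀ (i : Fin n) (t : A ⊗[k] A), smulD i t ∈ S := by
    intro i t
    obtain ⟨s, rfl⟩ := exists_lift_diffHom_eq t
    induction s with
    | zero => rw [map_zero, map_zero]; exact zero_mem _
    | add a b ha hb => rw [map_add, map_add]; exact add_mem ha hb
    | tmul f p =>
      rw [Algebra.TensorProduct.lift_tmul, Algebra.TensorProduct.includeLeft_apply,
        ← mk_mul_smulD]
      exact mul_mem (hf f) (hδ i p)
  have hη : ∀ η : Derivation k A A, (SmashProduct.mk k A 1 (vf k A η) : AV k n) ∈ S := by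
    intro η
    have e : (SmashProduct.mk k A 1 (vf k A η) : AV k n) = ∑ i, smulD i (1 ⊗ₜ η (X i)) := by
      simp only [smulD_tmul]
      conv_lhs => rw [derivation_eq_sum η, map_sum]
      exact TensorProduct.tmul_sum _ _ _
    rw [e]
    exact sum_mem fun i _ => hΦ i _
  have hu : ∀ u : UV k A, (SmashProduct.mk k A 1 u : AV k n) ∈ S := by
    intro u
    refine UV_induction (p := fun u => (SmashProduct.mk k A 1 u : AV k n) ∈ S) hη ?_ ?_ ?_ u
    · intro r
      have e : (SmashProduct.mk k A 1 (algebraMap k _ r) : AV k n) = algebraMap k _ r := by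
        rw [Algebra.algebraMap_eq_smul_one, Algebra.algebraMap_eq_smul_one]
        exact TensorProduct.tmul_smul r _ _
      rw [e]
      exact Subalgebra.algebraMap_mem _ r
    · intro a b ha hb
      have e : (SmashProduct.mk k A 1 (a + b) : AV k n) =
        SmashProduct.mk k A 1 a + SmashProduct.mk k A 1 b := TensorProduct.tmul_add _ _ _
      rw [e]
      exact add_mem ha hb
    · intro a b ha hb
      rw [← mk_one_mul_mk_one]
      exact mul_mem ha hb
  refine eq_top_iff.2 fun x _ => ?_
  induction x using SmashProduct.induction_on with
  | h0 => exact zero_mem _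
  | ha x y hx hy => exact add_mem (hx trivial) (hy trivial)
  | ht f u =>
    rw [← one_mul u, ← mk_one_mul_mk_one]
    exact mul_mem (hf f) (hu u)

end Centralizer

/-! ### Adapted generating pairs and the conclusion -/

section Main

variable {k : Type*} [Field k] {R : Type*} [Ring R] [Algebra k R]
  {M : Type*} [AddCommGroup M] [Module k M] [Module R M]

/-- The dimension is a supremum over generating pairs, and an empty supremum is `⊥`; so a finite
value makes R a finitely generated algebra. -/
theorem exists_isGeneratingPair_of_gkDim_ne_bot [IsScalarTower k R M] (h : gkDim k R M ≠ ⊥) :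
    ∃ (C : Submodule k R) (M₀ : Submodule k M), IsGeneratingPair k C M₀ := by
  by_contra! h0
  refine h (eq_bot_iff.2 ?_)
  exact iSup_le fun C => iSup_le fun M₀ => iSup_le fun h' => absurd h' (h0 C M₀)

/-- Finite generation lets finitely many elements of Z suffice next to ψ(B); their span E still
commutes with ψ(D), and M₀ is kept. -/
theorem exists_isGeneratingPair_sup {D : Type*} [Ring D] [Algebra k D] (ψ : D →ₐ[k] R)
    {B : Submodule k D} [FiniteDimensional k B] (hB : (1 : D) ∈ B) {Z : Set R}
    (hZ : ∀ z ∈ Z, ∀ d, z * ψ d = ψ d * z)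
    (htop : Algebra.adjoin k (ψ '' (B : Set D) ∪ Z) = ⊤) {C : Submodule k R} {M₀ : Submodule k M}
    (h : IsGeneratingPair k C M₀) : ∃ E : Submodule k R, (∀ e ∈ E, ∀ d, e * ψ d = ψ d * e) ∧
      IsGeneratingPair k (B.map ψ.toLinearMap ⊔ E) M₀ := by
  have := h.finite_left
  obtain ⟨T, hTZ, hT⟩ := exists_finset_adjoin_eq_top htop h.adjoin_eq_top
  refine ⟨Submodule.span k (T : Set R), fun e he d => ?_, inferInstance, ?_, ?_, h.finite_right,
    h.span_eq_top⟩
  · induction he using Submodule.span_induction with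
    | mem x hx => exact hZ x (hTZ hx) d
    | zero => rw [zero_mul, mul_zero]
    | add x y _ _ hx hy => rw [add_mul, mul_add, hx, hy]
    | smul c x _ hx => rw [smul_mul_assoc, mul_smul_comm, hx]
  · exact Submodule.mem_sup_left ⟨1, hB, map_one ψ⟩
  · refine eq_top_iff.2 (hT ▸ Algebra.adjoin_mono (Set.union_subset ?_ ?_))
    · rintro _ ⟨b, hb, rfl⟩
      exact Submodule.mem_sup_left ⟨b, hb, rfl⟩
    · exact fun t ht => Submodule.mem_sup_right (Submodule.subset_span ht)

end Main
end AVMod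
end

theorem mainTheorem6 {k : Type*} [Field k] [IsAlgClosed k] [CharZero k] [Uncountable k] (n : ℕ)
    (M : Type*) [AddCommGroup M] [Module k M] [Module (AVMod.AV k n) M]
    [IsScalarTower k (AVMod.AV k n) M]
    (hM : AVMod.IsHolonomic k (AVMod.AV k n) M n) :
    AVMod.IsHolonomic k (AVMod.WeylAlgebra k n) (AVMod.WeylRestrict k n M) n := by
  rcases subsingleton_or_nontrivial M with hs | hn
  · have : Subsingleton (AVMod.WeylRestrict k n M) := hs
    exact ⟨inferInstance, Or.inl this⟩
  · have hgk := hM.2.resolve_left (not_subsingleton M)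
    obtain ⟨C, M₀, h⟩ := AVMod.exists_isGeneratingPair_of_gkDim_ne_bot
      (k := k) (R := AVMod.AV k n) (M := M) (by rw [hgk]; exact EReal.natCast_ne_bot n)
    obtain ⟨E, hE, h'⟩ : ∃ E : Submodule k (AVMod.AV k n),
        (∀ e ∈ E, ∀ d, e * AVMod.weylToAV k n d = AVMod.weylToAV k n d * e) ∧
        AVMod.IsGeneratingPair k
          ((AVMod.weylGen k n).map (AVMod.weylToAV k n).toLinearMap ⊔ E) M₀ := by
      refine AVMod.exists_isGeneratingPair_sup (D := AVMod.WeylAlgebra k n) (AVMod.weylToAV k n)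
        (B := AVMod.weylGen k n) ?_ (Z := AVMod.weylCentralizer k n) ?_ ?_ h
      · exact AVMod.one_mem_genSpan
      · exact fun z hz => hz
      · exact AVMod.adjoin_weylGen_union_centralizer
    -- Both actions must live on one type. The restricted module is M itself, so the smash product
    -- action transfers and compatibility with ψ is definitional.
    let _ : Module (AVMod.AV k n) (AVMod.WeylRestrict k n M) :=
      inferInstanceAs (Module (AVMod.AV k n) M)
    have : IsScalarTower k (AVMod.AV k n) (AVMod.WeylRestrict k n M) :=
      inferInstanceAs (IsScalarTower k (AVMod.AV k n) M)
    have : Nontrivial (AVMod.WeylRestrict k n M) := hn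
    refine AVMod.isHolonomic_of_commuting (D := AVMod.WeylAlgebra k n) (R := AVMod.AV k n)
      (M := AVMod.WeylRestrict k n M) (K := 4 * n + 1) (by omega) (B := AVMod.weylGen k n)
      ?_ ?_ ?_ ?_ (AVMod.weylToAV k n) ?_ (E := E) hE (M₀ := M₀) ?_ hgk
    · exact AVMod.one_mem_genSpan
    · exact AVMod.adjoin_weylGen
    · exact fun N v hv q => AVMod.pow_le_finrank_weylGen_pow_smul hv q
    · exact fun v hv q => AVMod.pow_le_finrank_weylGen_pow_smul hv q
    · exact fun _ _ => rfl
    · exact h'
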